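/- Throughout, groups are finite, $\log$ is to base $2$, and $\log\log 1 := 0$. For a group $G$ and $k \ge 1$, the count-free $k$-dimensional Weisfeiler--Leman algorithm, Version I, colors the $k$-tuples of elements of $G$ as follows. Two tuples $(g_1,\dots,g_k)$, $(h_1,\dots,h_k)$ (possibly over different groups) receive the same initial color $\chi_0$ iff for all $i,j,\ell$ one has $g_ig_j=g_\ell \iff h_ih_j=h_\ell$ and $g_i=g_j \iff h_i=h_j$; and $$\chi_{\rho+1}(\bar g)=\bigl(\chi_\rho(\bar g),\ \{(\chi_\rho(\bar g(g_1/x)),\dots,\chi_\rho(\bar g(g_k/x))) : x\in G\}\bigr),$$ where $\bar g(g_i/x)$ is $\bar g$ with its $i$-th entry replaced by $x$. Count-free $(k,\rho)$-WL Version I distinguishes $G$ from $H$ if $\{\chi_\rho(\bar g):\bar g\in G^k\}\ne\{\chi_\rho(\bar h):\bar h\in H^k\}$. The solvability class of a solvable group is the least $\ell$ such that the $\ell$-th term of its derived series is trivial. $\mathsf{FO}(t(N))$ is the class of languages decided by uniform families of Boolean circuits with unbounded fan-in $\mathsf{AND}$, $\mathsf{OR}$ gates and $\mathsf{NOT}$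 gates, of size polynomial in the input length $N$ and depth $O(t(N))$; uniform means first-order uniform: gates are named by tuples (of fixed length) of numbers in $\{0,\dots,N\}$, and the circuit is described by fixed first-order formulas over $\{0,\dots,N\}$ with $\le,+,\times,\mathrm{BIT}$. **Theorem.** Let $d\ge 0$ be an integer. (1) There are constants $k$ and $C$, depending only on $d$, such that for every solvable group $G$ that is generated by at most $d$ elements, with order $n$ and solvability class $r$, and for every group $H\not\cong G$ (of any order), the count-free $(k,\lfloor C\, r\log\log n\rfloor)$-WL Version I algorithm distinguishes $G$ from $H$. (2) For every rational constant $c\ge 0$ and every constant $A$, isomorphism between $G$ and $H$, where $G$ is a solvable group generated by at most $d$ elements, with order $n$ and solvability class at most $A(\log\log n)^c$, and $H$ is an arbitrary group, can be decided in $\mathsf{FO}((\log\log N)^{c+1})$, where the input, of length $N$, is the pair of the Cayley tables of $G$ and $H$ (each entry written in binary). That is, there is a language in $\mathsf{FO}((\log\log N)^{c+1})$ which contains the encoding of such a pair $(G,H)$, for any numbering of the elements of $G$ and $H$, if and only if $G\cong H$. -/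

import Mathlib

/-! ### Iterated logarithm and solvability class -/

/-- `log₂ log₂ n`. It is a nonnegative real number for every `n`
(it is `0` for `n ≤ 2`). -/
noncomputable def loglog (n : ℕ) : ℝ := Real.logb 2 (Real.logb 2 n)

/-- The least `ℓ` such that the `ℓ`-th term of the derived series is trivial
(used for solvable groups only). -/
noncomputable def solvabilityClass (G : Type*) [Group G] : ℕ :=
  sInf {l : ℕ | derivedSeries G l = ⊥}

/-! ### Count-free Weisfeiler–Leman, Version I -/

namespace CountFreeWL

/-- The colors used for `k`-tuples after `r` rounds. They do not depend on the group, so that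
the colorings of two groups can be compared. -/
def Color (k : ℕ) : ℕ → Type
  | 0 => (Fin k → Fin k → Fin k → Prop) × (Fin k → Fin k → Prop)
  | r + 1 => Color k r × Set (Fin k → Color k r)

/-- The color of a `k`-tuple of group elements after `r` rounds of count-free `k`-dimensional
Weisfeiler–Leman Version I. The initial color records which products `g i * g j = g l` and which
equalities `g i = g j` hold; each round adds the set, over all `x` in the group, of the
`k`-tuples of colors obtained by replacing each single entry by `x`. -/
def color {G : Type*} [Group G] (k : ℕ) : (r : ℕ) → (Fin k → G) → Color k r
  | 0, g => (fun i j l => g i * g j = g l, fun i j => g i = g j)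
  | r + 1, g =>
    (color k r g, Set.range fun (x : G) (i : Fin k) => color k r (Function.update g i x))

/-- Count-free `(k, r)`-WL Version I distinguishes `G` from `H`: after `r` rounds the sets of
colors of `k`-tuples are different. -/
def Distinguishes (k r : ℕ) (G H : Type*) [Group G] [Group H] : Prop :=
  Set.range (color (G := G) k r) ≠ Set.range (color (G := H) k r)

end CountFreeWL

/-! ### Boolean circuits of unbounded fan-in -/

/-- The kinds of gates of a circuit with `N` input bits. -/
inductive GateKind (N : ℕ) : Type
  | input (i : Fin N)
  | and
  | or
  | not

/-- A Boolean circuit with `N` input bits and `AND`, `OR` (of unbounded fan-in) and `NOT` gates: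
a finite acyclic directed graph, in which `wire h g` says that the output of the gate `h` is fed
into the gate `g`. -/
structure BoolCircuit (N : ℕ) where
  Gate : Type
  finite_gate : Finite Gate
  kind : Gate → GateKind N
  wire : Gate → Gate → Prop
  output : Gate
  acyclic : WellFounded wire
  input_source : ∀ g i, kind g = GateKind.input i → ∀ h, ¬ wire h g
  not_unary : ∀ g, kind g = GateKind.not → ∃! h, wire h g

namespace BoolCircuit

variable {N : ℕ}

/-- The value of one gate, given the values of the gates that feed into it. -/
def evalStep (C : BoolCircuit N) (x : Fin N → Bool) (g : C.Gate)
    (val : (h : C.Gate) → C.wire h g → Prop) : Prop :=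
  match C.kind g with
  | GateKind.input i => x i = true
  | GateKind.and => ∀ (h : C.Gate) (w : C.wire h g), val h w
  | GateKind.or => ∃ (h : C.Gate) (w : C.wire h g), val h w
  | GateKind.not => ∀ (h : C.Gate) (w : C.wire h g), ¬ val h w

/-- The value of the gate `g` on the input `x` (`True` stands for `1`). -/
def eval (C : BoolCircuit N) (x : Fin N → Bool) : C.Gate → Prop :=
  C.acyclic.fix (evalStep C x)

theorem eval_eq (C : BoolCircuit N) (x : Fin N → Bool) (g : C.Gate) :
    C.eval x g = C.evalStep x g (fun h _ => C.eval x h) :=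
  C.acyclic.fix_eq (evalStep C x) g

/-- The circuit outputs `1` on the input `x`. -/
def Accepts (C : BoolCircuit N) (x : Fin N → Bool) : Prop := C.eval x C.output

/-- The number of gates. -/
noncomputable def size (C : BoolCircuit N) : ℕ := Nat.card C.Gate

/-- Every directed path in the circuit has at most `D` wires, i.e. the gates can be placed on
the levels `0, …, D` with every wire going up. -/
def DepthLE (C : BoolCircuit N) (D : ℕ) : Prop :=
  ∃ level : C.Gate → ℕ,
    (∀ h g, C.wire h g → level h < level g) ∧ ∀ g, level g ≤ D

end BoolCircuit

/-! ### Uniformity and the classes `FO(d(n))` -/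

/-- Symbols for the numerical predicates `≤`, `+`, `×` and `BIT`. -/
inductive NumRel : ℕ → Type
  | le : NumRel 2
  | add : NumRel 3
  | mul : NumRel 3
  | bit : NumRel 2

/-- The first-order language of the numerical predicates `≤`, `+`, `×` and `BIT`. -/
def numLang : FirstOrder.Language := ⟨fun _ => Empty, NumRel⟩

/-- The numerical predicates on `{0, …, N}`; `bit i y` says that the `i`-th binary digit of `y`
(counted from the least significant one) is `1`. -/
instance numStructure (N : ℕ) : numLang.Structure (Fin (N + 1)) where
  funMap := fun f _ => f.elim
  RelMap := fun {_} R =>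
    match R with
    | NumRel.le => fun v => (v 0 : ℕ) ≤ v 1
    | NumRel.add => fun v => (v 0 : ℕ) + v 1 = v 2
    | NumRel.mul => fun v => (v 0 : ℕ) * v 1 = v 2
    | NumRel.bit => fun v => Nat.testBit (v 1) (v 0) = true

/-- First-order uniformity of a circuit family: for some fixed `a`, the gates of the `N`-th
circuit are named by `a`-tuples of numbers from `{0, …, N}`, and the set of gate names, the
kinds of the gates, the output gate and the wires are defined by first-order formulas, the same
for all `N`, with the numerical predicates `≤`, `+`, `×`, `BIT`. -/
def FOUniform (C : (N : ℕ) → BoolCircuit N) : Prop :=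
  ∃ (a : ℕ) (isGate isAnd isOr isNot isOutput : numLang.Formula (Fin a))
    (isInput : numLang.Formula (Fin a ⊕ Unit)) (isWire : numLang.Formula (Fin a ⊕ Fin a)),
    ∀ N : ℕ, ∃ name : (C N).Gate → (Fin a → Fin (N + 1)),
      Function.Injective name ∧
      (∀ t : Fin a → Fin (N + 1), t ∈ Set.range name ↔ isGate.Realize t) ∧
      (∀ g, (C N).kind g = GateKind.and ↔ isAnd.Realize (name g)) ∧
      (∀ g, (C N).kind g = GateKind.or ↔ isOr.Realize (name g)) ∧
      (∀ g, (C N).kind g = GateKind.not ↔ isNot.Realize (name g)) ∧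
      (∀ g (i : Fin N), (C N).kind g = GateKind.input i ↔
        isInput.Realize (Sum.elim (name g) fun _ => i.castSucc)) ∧
      (∀ g, g = (C N).output ↔ isOutput.Realize (name g)) ∧
      (∀ h g, (C N).wire h g ↔ isWire.Realize (Sum.elim (name h) (name g)))

/-- `FO(d(n))`: the languages decided by uniform families of circuits with `AND`, `OR` and `NOT`
gates of unbounded fan-in, of polynomial size and depth `O(d(n))`, where `n` is the length of
the input. -/
def InFO (d : ℕ → ℝ) (L : Language Bool) : Prop :=
  ∃ C : (N : ℕ) → BoolCircuit N,
    FOUniform C ∧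
    (∃ p : Polynomial ℕ, ∀ N, (C N).size ≤ p.eval N) ∧
    (∃ D : ℕ → ℕ, (∀ N, (C N).DepthLE (D N)) ∧
      (fun N => (D N : ℝ)) =O[Filter.atTop] d) ∧
    ∀ x : List Bool, x ∈ L ↔ (C x.length).Accepts x.get

/-! ### Cayley tables as strings -/

/-- The Cayley table, as a bit string, of a group whose elements are numbered `0, …, n - 1`
by `e`: the `n ^ 2` entries in row-major order, each written with `⌈log₂ n⌉` binary digits,
the least significant digit first. -/
def cayleyString {G : Type*} [Group G] {n : ℕ} (e : G ≃ Fin n) : List Bool :=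
  List.ofFn fun p : Fin (n * n * Nat.clog 2 n) =>
    Nat.testBit (e (e.symm p.divNat.divNat * e.symm p.divNat.modNat)) p.modNat

/-- A string encoding a pair of strings: every bit is preceded by a tag, `0` for the bits of the
first string and `1` for the bits of the second one. -/
def pairString (x y : List Bool) : List Bool :=
  x.flatMap (fun b => [false, b]) ++ y.flatMap (fun b => [true, b])

/-! ### Short straight-line computations in finite abelian groups -/

/-- `SquareMulPath S m x y`: one gets from `x` to `y` in `m` steps, each of which squares the
current element or multiplies it by an element of `S`. -/
inductive SquareMulPath {G : Type*} [Group G] (S : Set G) : ℕ → G → G → Prop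
  | refl (x : G) : SquareMulPath S 0 x x
  | sq {m : ℕ} {x y : G} : SquareMulPath S m x y → SquareMulPath S (m + 1) x (y * y)
  | mul {m : ℕ} {x y s : G} :
      SquareMulPath S m x y → s ∈ S → SquareMulPath S (m + 1) x (y * s)

namespace SquareMulPath

variable {G : Type*} [Group G] {S : Set G}

theorem split {b : ℕ} : ∀ {a : ℕ} {x z : G}, SquareMulPath S (a + b) x z →
    ∃ y, SquareMulPath S a x y ∧ SquareMulPath S b y z := by
  induction b with
  | zero => exact fun h => ⟨_, h, refl _⟩
  | succ b ih =>
    intro a x z h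
    rw [← add_assoc] at h
    cases h with
    | sq h =>
      obtain ⟨y, h1, h2⟩ := ih h
      exact ⟨y, h1, h2.sq⟩
    | mul h hs =>
      obtain ⟨y, h1, h2⟩ := ih h
      exact ⟨y, h1, h2.mul hs⟩

theorem lift {K : Type*} [Group K] (f : K →* G) (S : Set K) {m : ℕ} {x y : G}
    (h : SquareMulPath (f '' S) m x y) :
    ∀ {x' : K}, f x' = x → ∃ y', f y' = y ∧ SquareMulPath S m x' y' := by
  induction h with
  | refl x => exact fun {x'} hx => ⟨x', hx, refl _⟩
  | sq _ ih =>
    intro x' hx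
    obtain ⟨y', rfl, h⟩ := ih hx
    exact ⟨y' * y', map_mul _ _ _, h.sq⟩
  | mul _ hs ih =>
    intro x' hx
    obtain ⟨y', rfl, h⟩ := ih hx
    obtain ⟨s, hs, rfl⟩ := hs
    exact ⟨y' * s, map_mul _ _ _, h.mul hs⟩

theorem map {K : Type*} [Group K] (f : G →* K) {m : ℕ} {x y : G}
    (h : SquareMulPath S m x y) : SquareMulPath (f '' S) m (f x) (f y) := by
  induction h with
  | refl x => exact refl _
  | sq _ ih => rw [map_mul]; exact ih.sq
  | mul _ hs ih => rw [map_mul]; exact ih.mul ⟨_, hs, rfl⟩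

theorem mul_prod {A : Type*} [CommGroup A] {S : Set A} (U : Finset A) (hU : ↑U ⊆ S) (f : A → ℕ)
    {m : ℕ} {x y : A} (h : SquareMulPath S m x y) :
    ∃ m' ≤ m + U.card, SquareMulPath S m' x (y * ∏ a ∈ U, a ^ (f a % 2)) := by
  classical
  induction U using Finset.induction_on with
  | empty => exact ⟨m, by simp, by simpa using h⟩
  | insert a U ha ih =>
    rw [Finset.coe_insert, Set.insert_subset_iff] at hU
    obtain ⟨m', hm', h'⟩ := ih hU.2
    rw [Finset.prod_insert ha, Finset.card_insert_of_notMem ha]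
    rcases Nat.mod_two_eq_zero_or_one (f a) with h0 | h1
    · exact ⟨m', by omega, by simpa [h0] using h'⟩
    · refine ⟨m' + 1, by omega, ?_⟩
      rw [h1, pow_one, mul_comm a, ← mul_assoc]
      exact h'.mul hU.1

/-- Horner's scheme, for all exponents at once. -/
theorem prod_pow {A : Type*} [CommGroup A] {S : Set A} (U : Finset A) (hU : ↑U ⊆ S) (b : ℕ) :
    ∀ f : A → ℕ, (∀ a, f a < 2 ^ b) →
      ∃ m ≤ b * (U.card + 1), SquareMulPath S m 1 (∏ a ∈ U, a ^ f a) := by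
  induction b with
  | zero =>
    intro f hf
    refine ⟨0, by simp, ?_⟩
    have : ∏ a ∈ U, a ^ f a = 1 := Finset.prod_eq_one fun a _ => by
      have := hf a
      rw [show f a = 0 by simpa using this, pow_zero]
    rw [this]
    exact refl _
  | succ b ih =>
    intro f hf
    obtain ⟨m, hm, h⟩ := ih (fun a => f a / 2) fun a => by
      have := hf a
      rw [pow_succ] at this
      omega
    obtain ⟨m', hm', h'⟩ := h.sq.mul_prod U hU f
    refine ⟨m', hm'.trans (by linarith), ?_⟩
    convert h' using 1
    rw [← Finset.prod_mul_distrib, ← Finset.prod_mul_distrib]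
    refine Finset.prod_congr rfl fun a _ => ?_
    rw [← pow_add, ← pow_add]
    congr 1
    omega

end SquareMulPath

theorem Subgroup.two_mul_card_le_of_lt {A : Type*} [Group A] [Finite A] {K L : Subgroup A}
    (h : K < L) : 2 * Nat.card K ≤ Nat.card L := by
  obtain ⟨c, hc⟩ := Subgroup.card_dvd_of_le h.le
  have hpos : 0 < Nat.card L := Nat.card_pos
  rcases Nat.lt_or_ge c 2 with h2 | h2
  · exfalso
    interval_cases c
    · omega
    · exact h.ne (Subgroup.eq_of_le_of_card_ge h.le (by omega))
  · rw [hc, mul_comm]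
    exact Nat.mul_le_mul_left _ h2

/-- A generating set of a finite group has a generating subset of logarithmic size. -/
theorem exists_small_generating_subset {A : Type*} [Group A] [Finite A] {S : Set A}
    (hS : Subgroup.closure S = ⊤) :
    ∃ U : Finset A, ↑U ⊆ S ∧ Subgroup.closure (U : Set A) = ⊤ ∧ 2 ^ U.card ≤ Nat.card A := by
  classical
  have := Fintype.ofFinite A
  let P : Finset (Finset A) := Finset.univ.filter fun U =>
    ↑U ⊆ S ∧ 2 ^ U.card ≤ Nat.card (Subgroup.closure (U : Set A))
  have hP : P.Nonempty := ⟨∅, by simp [P]⟩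
  obtain ⟨U, hU, hmax⟩ := P.exists_max_image Finset.card hP
  simp only [P, Finset.mem_filter, Finset.mem_univ, true_and] at hU hmax
  have htop : Subgroup.closure (U : Set A) = ⊤ := by
    by_contra hne
    have hex : ∃ s ∈ S, s ∉ Subgroup.closure (U : Set A) := by
      by_contra! hcon
      exact hne (top_le_iff.mp (hS ▸ (Subgroup.closure_le _).mpr hcon))
    obtain ⟨s, hs, hsU⟩ := hex
    have hsU' : s ∉ U := fun h => hsU (Subgroup.subset_closure h)
    have hlt : Subgroup.closure (U : Set A) < Subgroup.closure ((insert s U : Finset A) : Set A) := by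
      refine lt_of_le_of_ne (Subgroup.closure_mono (by simp)) fun heq => hsU ?_
      rw [heq]
      exact Subgroup.subset_closure (by simp)
    have := hmax (insert s U) ⟨by simpa [Set.insert_subset_iff] using ⟨hs, hU.1⟩, by
      rw [Finset.card_insert_of_notMem hsU', pow_succ, mul_comm]
      exact (Nat.mul_le_mul_left 2 hU.2).trans (Subgroup.two_mul_card_le_of_lt hlt)⟩
    rw [Finset.card_insert_of_notMem hsU'] at this
    omega
  exact ⟨U, hU.1, htop, hU.2.trans (Subgroup.card_le_card_group _)⟩

/-- In a finite abelian group every element has a computation of quadratic length in the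
logarithm of the order. -/
theorem exists_squareMulPath {A : Type*} [CommGroup A] [Finite A] {S : Set A}
    (hS : Subgroup.closure S = ⊤) {n : ℕ} (hn : Nat.card A ≤ n) (x : A) :
    ∃ m ≤ (Nat.log 2 n + 1) * (Nat.log 2 n + 1), SquareMulPath S m 1 x := by
  classical
  obtain ⟨U, hU, htop, hcard⟩ := exists_small_generating_subset hS
  have hx : x ∈ Submonoid.closure (U : Set A) := by
    rw [← Subgroup.closure_toSubmonoid_of_finite, htop]
    trivial
  obtain ⟨f, -, rfl⟩ := Submonoid.mem_closure_finset.mp hx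
  have hlt : Nat.card A < 2 ^ (Nat.log 2 n + 1) :=
    hn.trans_lt (Nat.lt_pow_succ_log_self one_lt_two n)
  obtain ⟨m, hm, h⟩ := SquareMulPath.prod_pow U hU (Nat.log 2 n + 1) (fun a => f a % Nat.card A)
    fun a => (Nat.mod_lt _ Nat.card_pos).trans hlt
  refine ⟨m, hm.trans (Nat.mul_le_mul_left _ (Nat.succ_le_succ ?_)), ?_⟩
  · exact Nat.le_log_of_pow_le one_lt_two (hcard.trans hn)
  · convert h using 1
    exact Finset.prod_congr rfl fun a _ => (pow_mod_natCard a _).symm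

/-! ### Pebble games -/

/-- A pebble game with `k` pairs of pebbles on two groups: `rel T p q` means that the position
`(p, q)` is not lost for the second player in `T` further rounds. -/
structure PebbleGame (k : ℕ) (G H : Type*) [Group G] [Group H] where
  rel : ℕ → (Fin k → G) → (Fin k → H) → Prop
  mono : ∀ {T p q}, rel (T + 1) p q → rel T p q
  mul : ∀ {T p q}, rel T p q → ∀ i j l, p i * p j = p l → q i * q j = q l
  eq_iff : ∀ {T p q}, rel T p q → ∀ i j, p i = p j ↔ q i = q j
  forth : ∀ {T p q}, rel (T + 1) p q → ∀ i x,
    ∃ y, rel T (Function.update p i x) (Function.update q i y)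

namespace PebbleGame

variable {d : ℕ} {G H : Type*} [Group G] [Group H]

/-- The first `d` pebbles lie on the given tuples. -/
def Extends (g : Fin d → G) (h : Fin d → H) (p : Fin (d + 3) → G) (q : Fin (d + 3) → H) : Prop :=
  (∀ i, p (Fin.castAdd 3 i) = g i) ∧ ∀ i, q (Fin.castAdd 3 i) = h i

variable (R : PebbleGame (d + 3) G H) (g : Fin d → G) (h : Fin d → H)

/-- In positions with `T` rounds to go, a free pebble on `x` is matched by a pebble on `y`. -/
def Forces (T : ℕ) (x : G) (y : H) : Prop :=
  ∀ p q, Extends g h p q → R.rel T p q → ∀ a : Fin 3, p (Fin.natAdd d a) = x →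
    q (Fin.natAdd d a) = y

/-- In positions with `T` rounds to go, free pebbles on `x` and `x'` are matched by pebbles on
some `y` and on `f y`. -/
def Carries (T : ℕ) (x x' : G) (f : H → H) : Prop :=
  ∀ p q, Extends g h p q → R.rel T p q → ∀ a b : Fin 3, a ≠ b → p (Fin.natAdd d a) = x →
    p (Fin.natAdd d b) = x' → q (Fin.natAdd d b) = f (q (Fin.natAdd d a))

variable {R g h}

theorem rel_of_le {T T' : ℕ} (hT : T ≤ T') {p : Fin (d + 3) → G} {q : Fin (d + 3) → H}
    (hr : R.rel T' p q) : R.rel T p q := by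
  induction hT with
  | refl => exact hr
  | step _ ih => exact ih (R.mono hr)

theorem Forces.of_le {T T' : ℕ} {x : G} {y : H} (hx : Forces R g h T x y) (hT : T ≤ T') :
    Forces R g h T' x y := fun p q he hr => hx p q he (rel_of_le hT hr)

theorem Carries.of_le {T T' : ℕ} {x x' : G} {f : H → H} (hx : Carries R g h T x x' f)
    (hT : T ≤ T') : Carries R g h T' x x' f := fun p q he hr => hx p q he (rel_of_le hT hr)

theorem place {T : ℕ} {p : Fin (d + 3) → G} {q : Fin (d + 3) → H} (he : Extends g h p q)
    (hr : R.rel (T + 1) p q) (a : Fin 3) (x : G) :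
    ∃ p' q', Extends g h p' q' ∧ R.rel T p' q' ∧ p' (Fin.natAdd d a) = x ∧
      ∀ b, b ≠ a → p' (Fin.natAdd d b) = p (Fin.natAdd d b) ∧
        q' (Fin.natAdd d b) = q (Fin.natAdd d b) := by
  obtain ⟨y, hy⟩ := R.forth hr (Fin.natAdd d a) x
  have hne (i : Fin d) : Fin.castAdd 3 i ≠ Fin.natAdd d a := fun hi => by
    have := congrArg Fin.val hi
    simp at this
    omega
  refine ⟨_, _, ⟨fun i => ?_, fun i => ?_⟩, hy, by simp, fun b hb => ?_⟩
  · rw [Function.update_of_ne (hne i), he.1]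
  · rw [Function.update_of_ne (hne i), he.2]
  · have hb' : Fin.natAdd d b ≠ Fin.natAdd d a := fun hh => hb (by simpa using hh)
    rw [Function.update_of_ne hb', Function.update_of_ne hb']
    exact ⟨rfl, rfl⟩

theorem exists_third (a b : Fin 3) : ∃ c, c ≠ a ∧ c ≠ b := by
  revert a b
  decide

theorem forces_one : Forces R g h 0 1 1 := by
  intro p q _ hr a ha
  have := R.mul hr (Fin.natAdd d a) (Fin.natAdd d a) (Fin.natAdd d a) (by simp [ha])
  simpa using this

theorem forces_generator (i : Fin d) : Forces R g h 0 (g i) (h i) := by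
  intro p q he hr a ha
  rw [← he.2 i]
  exact (R.eq_iff hr _ _).mp (ha.trans (he.1 i).symm)

theorem Forces.mul {T : ℕ} {x x' : G} {y y' : H} (hx : Forces R g h T x y)
    (hx' : Forces R g h T x' y') : Forces R g h (T + 2) (x * x') (y * y') := by
  intro p q he hr a ha
  obtain ⟨b, hba, -⟩ := exists_third a a
  obtain ⟨c, hca, hcb⟩ := exists_third a b
  obtain ⟨p1, q1, he1, hr1, hp1, hs1⟩ := place he hr b x
  obtain ⟨p2, q2, he2, hr2, hp2, hs2⟩ := place he1 hr1 c x'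
  rw [← (hs1 a hba.symm).1, ← (hs2 a hca.symm).1] at ha
  rw [← (hs1 a hba.symm).2, ← (hs2 a hca.symm).2]
  rw [← (hs2 b hcb.symm).1] at hp1
  rw [← hx p2 q2 he2 hr2 b hp1, ← hx' p2 q2 he2 hr2 c hp2]
  exact (R.mul hr2 _ _ _ (by rw [hp1, hp2, ha])).symm

theorem Forces.inv {T : ℕ} {x : G} {y : H} (hx : Forces R g h T x y) :
    Forces R g h (T + 2) x⁻¹ y⁻¹ := by
  intro p q he hr a ha
  obtain ⟨b, hba, -⟩ := exists_third a a
  obtain ⟨c, hca, hcb⟩ := exists_third a b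
  obtain ⟨p1, q1, he1, hr1, hp1, hs1⟩ := place he hr b x
  obtain ⟨p2, q2, he2, hr2, hp2, hs2⟩ := place he1 hr1 c 1
  rw [← (hs1 a hba.symm).1, ← (hs2 a hca.symm).1] at ha
  rw [← (hs1 a hba.symm).2, ← (hs2 a hca.symm).2]
  rw [← (hs2 b hcb.symm).1] at hp1
  have h1 := forces_one p2 q2 he2 (rel_of_le (Nat.zero_le T) hr2) c hp2
  rw [← hx p2 q2 he2 hr2 b hp1, eq_inv_iff_mul_eq_one, ← h1]
  exact R.mul hr2 _ _ _ (by rw [hp1, hp2, ha, inv_mul_cancel])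

theorem carries_refl (x : G) : Carries R g h 0 x x id := by
  intro p q _ hr a b _ ha hb
  exact (R.eq_iff hr _ _).mp (hb.trans ha.symm)

theorem carries_sq (x : G) : Carries R g h 0 x (x * x) fun y => y * y := by
  intro p q _ hr a b _ ha hb
  exact (R.mul hr _ _ _ (by rw [ha, hb])).symm

theorem Forces.carries {T : ℕ} {s : G} {t : H} (hs : Forces R g h T s t) (x : G) :
    Carries R g h (T + 1) x (x * s) fun y => y * t := by
  intro p q he hr a b hab ha hb
  obtain ⟨c, hca, hcb⟩ := exists_third a b
  obtain ⟨p1, q1, he1, hr1, hp1, hs1⟩ := place he hr c s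
  rw [← (hs1 a hca.symm).1] at ha
  rw [← (hs1 b hcb.symm).1] at hb
  rw [← (hs1 a hca.symm).2, ← (hs1 b hcb.symm).2, ← hs p1 q1 he1 hr1 c hp1]
  exact (R.mul hr1 _ _ _ (by rw [ha, hb, hp1])).symm

theorem Carries.comp {T : ℕ} {x y z : G} {f f' : H → H} (h1 : Carries R g h T x y f)
    (h2 : Carries R g h T y z f') : Carries R g h (T + 1) x z (f' ∘ f) := by
  intro p q he hr a b hab ha hb
  obtain ⟨c, hca, hcb⟩ := exists_third a b
  obtain ⟨p1, q1, he1, hr1, hp1, hs1⟩ := place he hr c y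
  rw [← (hs1 a hca.symm).1] at ha
  rw [← (hs1 b hcb.symm).1] at hb
  rw [← (hs1 a hca.symm).2, ← (hs1 b hcb.symm).2, h2 p1 q1 he1 hr1 c b hcb hp1 hb,
    h1 p1 q1 he1 hr1 a c hca.symm ha hp1, Function.comp_apply]

theorem Carries.forces {T : ℕ} {x : G} {f : H → H} (hf : Carries R g h T 1 x f) :
    Forces R g h (T + 1) x (f 1) := by
  intro p q he hr a ha
  obtain ⟨b, hba, -⟩ := exists_third a a
  obtain ⟨p1, q1, he1, hr1, hp1, hs1⟩ := place he hr b 1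
  rw [← (hs1 a hba.symm).1] at ha
  rw [← (hs1 a hba.symm).2, hf p1 q1 he1 hr1 b a hba hp1 ha,
    forces_one p1 q1 he1 (rel_of_le (Nat.zero_le T) hr1) b hp1]

/-- A path of length `2 ^ l` is followed in `l` rounds, by bisection. -/
theorem carries_of_squareMulPath {T : ℕ} {S : Set G} (hS : ∀ s ∈ S, ∃ t, Forces R g h T s t)
    (l : ℕ) : ∀ {m : ℕ} {x y : G}, m ≤ 2 ^ l → SquareMulPath S m x y →
      ∃ f, Carries R g h (T + 1 + l) x y f := by
  induction l with
  | zero =>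
    intro m x y hm hp
    cases hp with
    | refl => exact ⟨_, (carries_refl x).of_le (by omega)⟩
    | @sq m x y hp =>
      obtain rfl : m = 0 := by simpa using hm
      cases hp
      exact ⟨_, (carries_sq x).of_le (by omega)⟩
    | @mul m x y s hp hs =>
      obtain rfl : m = 0 := by simpa using hm
      cases hp
      obtain ⟨t, ht⟩ := hS s hs
      exact ⟨_, ht.carries x⟩
  | succ l ih =>
    intro m x y hm hp
    rw [pow_succ] at hm
    rw [show m = m / 2 + (m - m / 2) by omega] at hp
    obtain ⟨z, h1, h2⟩ := hp.split
    obtain ⟨f, hf⟩ := ih (by omega) h1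
    obtain ⟨f', hf'⟩ := ih (by omega) h2
    exact ⟨_, hf.comp hf'⟩

/-- The number of rounds in which one term of the derived series is dealt with. -/
def layerRounds (n : ℕ) : ℕ := 8 + Nat.clog 2 ((Nat.log 2 n + 1) * (Nat.log 2 n + 1))

/-- If all cosets of a normal subgroup `M` have forced representatives, then `M` is generated by
forced elements. -/
theorem closure_forces_eq [Finite G] {M : Subgroup G} {T : ℕ}
    (hg : Subgroup.closure (Set.range g) = ⊤)
    (hM : ∀ x : G, ∃ w y, Forces R g h T w y ∧ x * w⁻¹ ∈ M) :
    Subgroup.closure {s : M | ∃ t, Forces R g h (T + 4) (s : G) t} = ⊤ := by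
  set U : Set M := {s : M | ∃ t, Forces R g h (T + 4) (s : G) t}
  have key : ∀ x : G, ∀ w y, Forces R g h T w y → ∀ hx : x * w⁻¹ ∈ M,
      (⟨x * w⁻¹, hx⟩ : M) ∈ Subgroup.closure U := by
    intro x
    have hx : x ∈ Submonoid.closure (Set.range g) := by
      rw [← Subgroup.closure_toSubmonoid_of_finite, hg]
      trivial
    induction hx using Submonoid.closure_induction_right with
    | one =>
      intro w y hw hx
      refine Subgroup.subset_closure ⟨y⁻¹, ?_⟩
      have := hw.inv.of_le (show T + 2 ≤ T + 4 by omega)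
      simpa using this
    | mul_right x _ s hs ih =>
      obtain ⟨i, rfl⟩ := hs
      intro w y hw hx
      obtain ⟨w1, y1, hw1, hx1⟩ := hM x
      have hmem : w1 * g i * w⁻¹ ∈ M := by
        have := M.mul_mem (M.inv_mem hx1) hx
        convert this using 1
        group
      have heq : (⟨x * g i * w⁻¹, hx⟩ : M) = ⟨x * w1⁻¹, hx1⟩ * ⟨w1 * g i * w⁻¹, hmem⟩ := by
        ext
        simp only [Subgroup.coe_mul]
        group
      rw [heq]
      exact Subgroup.mul_mem _ (ih w1 y1 hw1 hx1) (Subgroup.subset_closure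
        ⟨_, (hw1.mul ((forces_generator i).of_le (Nat.zero_le T))).mul hw.inv⟩)
  refine (Subgroup.eq_top_iff' _).mpr fun u => ?_
  have := key u 1 1 (forces_one.of_le (Nat.zero_le T)) (by simp)
  simpa using this

theorem exists_forces_derivedSeries [Finite G] (hg : Subgroup.closure (Set.range g) = ⊤)
    (i : ℕ) : ∀ x : G, ∃ w y, Forces R g h (i * layerRounds (Nat.card G)) w y ∧
      x * w⁻¹ ∈ derivedSeries G i := by
  induction i with
  | zero => exact fun x => ⟨1, 1, forces_one.of_le (Nat.zero_le _), by simp⟩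
  | succ i ih =>
    intro x
    set M := derivedSeries G i
    set T := i * layerRounds (Nat.card G)
    obtain ⟨w, y, hw, hx⟩ := ih x
    have htop := closure_forces_eq hg ih
    set U : Set M := {s : M | ∃ t, Forces R g h (T + 4) (s : G) t}
    have htop' : Subgroup.closure ((Abelianization.of : M →* Abelianization M) '' U) = ⊤ := by
      rw [← MonoidHom.map_closure, htop, ← MonoidHom.range_eq_map, MonoidHom.range_eq_top]
      exact QuotientGroup.mk'_surjective _
    have hcard : Nat.card (Abelianization M) ≤ Nat.card G :=
      (Nat.card_le_card_of_surjective _ (QuotientGroup.mk'_surjective _)).trans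
        (Subgroup.card_le_card_group M)
    obtain ⟨m, hm, hp⟩ := exists_squareMulPath htop' hcard (Abelianization.of ⟨_, hx⟩)
    obtain ⟨u, hu, hp'⟩ := hp.lift _ _ (map_one _)
    have hp'' := hp'.map M.subtype
    obtain ⟨f, hf⟩ := carries_of_squareMulPath (T := T + 4) (R := R) (g := g) (h := h)
      (by rintro - ⟨s, hs, rfl⟩; exact hs) _ (hm.trans (Nat.le_pow_clog one_lt_two _)) hp''
    rw [map_one] at hf
    refine ⟨u * w, f 1 * y, ?_, ?_⟩
    · refine (hf.forces.mul (hw.of_le ?_)).of_le ?_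
      · omega
      · have : (i + 1) * layerRounds (Nat.card G) = T + layerRounds (Nat.card G) := Nat.succ_mul _ _
        rw [this, layerRounds]
        omega
    · have hmem : (⟨x * w⁻¹, hx⟩ : M) * u⁻¹ ∈ commutator M := by
        rw [← QuotientGroup.eq_one_iff]
        change Abelianization.of _ = 1
        rw [map_mul, map_inv, hu, mul_inv_cancel]
      have := Subgroup.mem_map_of_mem M.subtype hmem
      rw [Subgroup.map_subtype_commutator] at this
      rw [derivedSeries_succ, mul_inv_rev, ← mul_assoc]
      simpa using this

/-- If a position with generators of `G` under the first pebbles is not lost in as many rounds,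
then the pebbled elements define an embedding. -/
theorem exists_injective_hom [Finite G] (hg : Subgroup.closure (Set.range g) = ⊤) {r : ℕ}
    (hr : derivedSeries G r = ⊥) {p : Fin (d + 3) → G} {q : Fin (d + 3) → H}
    (he : Extends g h p q) (hpq : R.rel (r * layerRounds (Nat.card G) + 3) p q) :
    ∃ φ : G →* H, Function.Injective φ ∧ ∀ x, Forces R g h (r * layerRounds (Nat.card G)) x (φ x) := by
  set T := r * layerRounds (Nat.card G)
  have hex : ∀ x : G, ∃ y, Forces R g h T x y := fun x => by
    obtain ⟨w, y, hw, hx⟩ := exists_forces_derivedSeries (R := R) (h := h) hg r x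
    rw [hr, Subgroup.mem_bot, mul_inv_eq_one] at hx
    exact ⟨y, hx ▸ hw⟩
  choose f hf using hex
  have hthree : ∀ x y z : G, ∃ p' q', Extends g h p' q' ∧ R.rel T p' q' ∧
      p' (Fin.natAdd d 0) = x ∧ p' (Fin.natAdd d 1) = y ∧ p' (Fin.natAdd d 2) = z := by
    intro x y z
    obtain ⟨p1, q1, he1, hr1, hp1, hs1⟩ := place he hpq 0 x
    obtain ⟨p2, q2, he2, hr2, hp2, hs2⟩ := place he1 hr1 1 y
    obtain ⟨p3, q3, he3, hr3, hp3, hs3⟩ := place he2 hr2 2 z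
    exact ⟨p3, q3, he3, hr3, by rw [(hs3 0 (by decide)).1, (hs2 0 (by decide)).1, hp1],
      by rw [(hs3 1 (by decide)).1, hp2], hp3⟩
  have hmul : ∀ x y, f (x * y) = f x * f y := by
    intro x y
    obtain ⟨p', q', he', hr', h0, h1, h2⟩ := hthree x y (x * y)
    rw [← hf x p' q' he' hr' 0 h0, ← hf y p' q' he' hr' 1 h1, ← hf _ p' q' he' hr' 2 h2]
    exact (R.mul hr' _ _ _ (by rw [h0, h1, h2])).symm
  refine ⟨MonoidHom.mk' f hmul, fun x y hxy => ?_, hf⟩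
  obtain ⟨p', q', he', hr', h0, h1, -⟩ := hthree x y 1
  have : f x = f y := hxy
  rw [← hf x p' q' he' hr' 0 h0, ← hf y p' q' he' hr' 1 h1] at this
  rw [← h0, ← h1]
  exact (R.eq_iff hr' _ _).mpr this

end PebbleGame

theorem exists_generating_tuple {G : Type*} [Group G] [Finite G] {d : ℕ} (hd : Group.rank G ≤ d) :
    ∃ g : Fin d → G, Subgroup.closure (Set.range g) = ⊤ := by
  obtain ⟨S, hS, htop⟩ := Group.rank_spec G
  let e := S.equivFin
  refine ⟨fun i => if hi : i.1 < S.card then e.symm ⟨i, hi⟩ else 1, top_le_iff.mp ?_⟩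
  rw [← htop]
  refine Subgroup.closure_mono fun s hs => ⟨⟨e ⟨s, hs⟩, by have := (e ⟨s, hs⟩).2; omega⟩, ?_⟩
  simp

/-! ### Count-free Weisfeiler–Leman on solvable groups -/

namespace CountFreeWL

variable {k : ℕ} {G H : Type*} [Group G] [Group H]

theorem color_zero_eq {r : ℕ} {p : Fin k → G} {q : Fin k → H} (h : color k r p = color k r q) :
    color k 0 p = color k 0 q := by
  induction r with
  | zero => exact h
  | succ r ih => exact ih (congrArg Prod.fst h)

theorem exists_color_update_eq {r : ℕ} {p : Fin k → G} {q : Fin k → H}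
    (h : color k (r + 1) p = color k (r + 1) q) (i : Fin k) (x : G) :
    ∃ y, color k r (Function.update p i x) = color k r (Function.update q i y) := by
  have hset : Set.range (fun (x : G) (i : Fin k) => color k r (Function.update p i x)) =
      Set.range fun (y : H) (i : Fin k) => color k r (Function.update q i y) :=
    congrArg Prod.snd h
  obtain ⟨y, hy⟩ := hset ▸ Set.mem_range_self (f := fun (x : G) (i : Fin k) =>
    color k r (Function.update p i x)) x
  exact ⟨y, (congrFun hy i).symm⟩

/-- Equality of colors, as a pebble game. -/
def colorGame (k : ℕ) (G H : Type*) [Group G] [Group H] : PebbleGame k G H where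
  rel r p q := color k r p = color k r q
  mono h := congrArg Prod.fst h
  mul h i j l := by
    have := congrFun (congrFun (congrFun (congrArg Prod.fst (color_zero_eq h)) i) j) l
    exact (iff_of_eq this).mp
  eq_iff h i j := iff_of_eq (congrFun (congrFun (congrArg Prod.snd (color_zero_eq h)) i) j)
  forth h i x := exists_color_update_eq h i x

theorem exists_color_eq {r : ℕ} (h : Set.range (color (G := G) k r) = Set.range (color (G := H) k r))
    (p : Fin k → G) : ∃ q : Fin k → H, color k r p = color k r q := by
  obtain ⟨q, hq⟩ := h ▸ Set.mem_range_self (f := color (G := G) k r) p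
  exact ⟨q, hq.symm⟩

theorem le_card_of_range_color_eq [Finite G] [Finite H] {r : ℕ}
    (h : Set.range (color (G := G) k r) = Set.range (color (G := H) k r)) {m : ℕ} (hm : m ≤ k)
    (hG : m ≤ Nat.card G) : m ≤ Nat.card H := by
  let e := Finite.equivFin G
  obtain ⟨q, hq⟩ := exists_color_eq h fun i : Fin k =>
    if hi : i.1 < Nat.card G then e.symm ⟨i, hi⟩ else 1
  have hinj : Function.Injective fun i : Fin m => q (Fin.castLE hm i) := by
    intro i j hij
    have := ((colorGame k G H).eq_iff hq _ _).mpr hij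
    simp only [Fin.val_castLE] at this
    rw [dif_pos (i.2.trans_le hG), dif_pos (j.2.trans_le hG)] at this
    simpa [Fin.ext_iff] using this
  simpa using Nat.card_le_card_of_injective _ hinj

theorem nonempty_mulEquiv_of_card_le_two [Finite G] [Finite H] {r : ℕ} (hk : 3 ≤ k)
    (h : Set.range (color (G := G) k r) = Set.range (color (G := H) k r))
    (hG : Nat.card G ≤ 2) : Nonempty (G ≃* H) := by
  have hH : Nat.card H ≤ 2 := by
    by_contra hH
    have := le_card_of_range_color_eq h.symm hk (by omega)
    omega
  have heq : Nat.card G = Nat.card H :=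
    le_antisymm (le_card_of_range_color_eq h (by omega) le_rfl)
      (le_card_of_range_color_eq h.symm (by omega) le_rfl)
  have hpos : 0 < Nat.card G := Nat.card_pos
  obtain h1 | h2 : Nat.card G = 1 ∨ Nat.card G = 2 := by omega
  · have : Subsingleton G := (Nat.card_eq_one_iff_unique.mp h1).1
    have : Subsingleton H := (Nat.card_eq_one_iff_unique.mp (heq ▸ h1)).1
    exact ⟨MulEquiv.ofBijective (1 : G →* H)
      ⟨fun _ _ _ => Subsingleton.elim _ _, fun _ => ⟨1, Subsingleton.elim _ _⟩⟩⟩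
  · have : Fact (Nat.Prime 2) := ⟨Nat.prime_two⟩
    exact ⟨mulEquivOfPrimeCardEq h2 (heq ▸ h2)⟩

theorem nonempty_mulEquiv_of_range_color_eq [Finite G] {d : ℕ} (hd : Group.rank G ≤ d)
    {r T : ℕ} (hr : derivedSeries G r = ⊥)
    (hT : r * PebbleGame.layerRounds (Nat.card G) + 4 ≤ T)
    (h : Set.range (color (G := G) (d + 3) T) = Set.range (color (G := H) (d + 3) T)) :
    Nonempty (G ≃* H) := by
  obtain ⟨g, hg⟩ := exists_generating_tuple hd
  obtain ⟨q, hq⟩ := exists_color_eq h (Fin.append g fun _ => 1)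
  have he : PebbleGame.Extends g (fun i => q (Fin.castAdd 3 i)) (Fin.append g fun _ => 1) q :=
    ⟨fun i => by simp, fun i => rfl⟩
  have hrel : (colorGame (d + 3) G H).rel T (Fin.append g fun _ => 1) q := hq
  have hrel' := PebbleGame.rel_of_le hT hrel
  obtain ⟨φ, hφ, hf⟩ := PebbleGame.exists_injective_hom hg hr he
    (PebbleGame.rel_of_le (by omega) hrel)
  refine ⟨MulEquiv.ofBijective φ ⟨hφ, fun y => ?_⟩⟩
  obtain ⟨x, hx⟩ := exists_color_update_eq (Eq.symm hrel') (Fin.natAdd d 0) y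
  have hrel'' : (colorGame (d + 3) G H).rel (r * PebbleGame.layerRounds (Nat.card G) + 3) _ _ :=
    hx.symm
  have hne (i : Fin d) : Fin.castAdd 3 i ≠ Fin.natAdd d 0 := fun hi => by
    have := congrArg Fin.val hi
    simp at this
    omega
  have := hf x _ _ ⟨fun i => by rw [Function.update_of_ne (hne i), he.1],
    fun i => by rw [Function.update_of_ne (hne i)]⟩
    (PebbleGame.rel_of_le (Nat.le_add_right _ 3) hrel'') 0 (by simp)
  exact ⟨x, by simpa using this.symm⟩

end CountFreeWL

theorem derivedSeries_solvabilityClass {G : Type*} [Group G] (h : Group.IsSolvable G) :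
    derivedSeries G (solvabilityClass G) = ⊥ :=
  Nat.sInf_mem (s := {l : ℕ | derivedSeries G l = ⊥}) h.solvable

theorem solvabilityClass_pos {G : Type*} [Group G] [Nontrivial G] (h : Group.IsSolvable G) :
    0 < solvabilityClass G := by
  rw [Nat.pos_iff_ne_zero]
  intro h0
  have := derivedSeries_solvabilityClass h
  rw [h0, derivedSeries_zero] at this
  exact top_ne_bot this

theorem natLog_natLog_le_loglog {n : ℕ} (hn : 2 ≤ n) :
    (Nat.log 2 (Nat.log 2 n) : ℝ) ≤ loglog n := by
  have h1 : (1 : ℕ) ≤ Nat.log 2 n := Nat.log_pos one_lt_two hn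
  have h1' : (1 : ℝ) ≤ (Nat.log 2 n : ℝ) := by exact_mod_cast h1
  calc (Nat.log 2 (Nat.log 2 n) : ℝ) ≤ Real.logb 2 (Nat.log 2 n : ℝ) := by
        exact_mod_cast Real.natLog_le_logb (Nat.log 2 n) 2
    _ ≤ loglog n := Real.logb_le_logb_of_le one_lt_two (by linarith)
        (by exact_mod_cast Real.natLog_le_logb n 2)

theorem PebbleGame.layerRounds_le {n : ℕ} (hn : 2 ≤ n) :
    PebbleGame.layerRounds n ≤ 10 + 2 * Nat.log 2 (Nat.log 2 n) := by
  have h1 : (1 : ℕ) ≤ Nat.log 2 n := Nat.log_pos one_lt_two hn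
  have h2 : Nat.log 2 n + 1 ≤ 2 ^ (Nat.log 2 (Nat.log 2 n) + 1) :=
    Nat.lt_pow_succ_log_self one_lt_two _
  have h3 : Nat.clog 2 ((Nat.log 2 n + 1) * (Nat.log 2 n + 1)) ≤
      2 * (Nat.log 2 (Nat.log 2 n) + 1) := by
    refine Nat.clog_le_of_le_pow ?_
    rw [two_mul, pow_add]
    exact Nat.mul_le_mul h2 h2
  rw [PebbleGame.layerRounds]
  omega

theorem half_le_loglog {n : ℕ} (hn : 3 ≤ n) : (1 / 2 : ℝ) ≤ loglog n := by
  have hn' : (3 : ℝ) ≤ n := by exact_mod_cast hn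
  have h1 : (3 / 2 : ℝ) ≤ Real.logb 2 n := by
    rw [Real.le_logb_iff_rpow_le one_lt_two (by linarith)]
    refine le_trans ?_ hn'
    rw [show (3 / 2 : ℝ) = 3 * (1 / 2) by norm_num, Real.rpow_mul (by norm_num),
      ← Real.sqrt_eq_rpow]
    exact Real.sqrt_le_iff.mpr ⟨by norm_num, by norm_num⟩
  rw [loglog, Real.le_logb_iff_rpow_le one_lt_two (by linarith)]
  refine le_trans ?_ h1
  rw [← Real.sqrt_eq_rpow]
  exact Real.sqrt_le_iff.mpr ⟨by norm_num, by norm_num⟩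

theorem distinguishes_of_solvable {d : ℕ} {G H : Type*} [Group G] [Finite G] [Group H] [Finite H]
    (hG : Group.IsSolvable G) (hd : Group.rank G ≤ d) (h : ¬ Nonempty (G ≃* H)) :
    CountFreeWL.Distinguishes (d + 3) ⌊(30 : ℝ) * solvabilityClass G * loglog (Nat.card G)⌋₊ G H := by
  intro heq
  refine h ?_
  rcases Nat.lt_or_ge 2 (Nat.card G) with hn | hn
  · refine CountFreeWL.nonempty_mulEquiv_of_range_color_eq hd (derivedSeries_solvabilityClass hG)
      (Nat.le_floor ?_) heq
    have : Nontrivial G := Finite.one_lt_card_iff_nontrivial.mp (by omega)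
    have hr : (1 : ℝ) ≤ solvabilityClass G := by exact_mod_cast solvabilityClass_pos hG
    have h1 := half_le_loglog hn
    have h2 := natLog_natLog_le_loglog hn.le
    have h3 : (PebbleGame.layerRounds (Nat.card G) : ℝ) ≤
        10 + 2 * (Nat.log 2 (Nat.log 2 (Nat.card G)) : ℝ) := by
      exact_mod_cast PebbleGame.layerRounds_le hn.le
    push_cast
    nlinarith [mul_le_mul_of_nonneg_left (h3.trans (show _ ≤ 22 * loglog (Nat.card G) by linarith))
      (zero_le_one.trans hr), mul_le_mul hr h1 (by norm_num) (by linarith)]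
  · exact CountFreeWL.nonempty_mulEquiv_of_card_le_two (by omega) heq hn

/-! ### Uniformly definable predicates and functions -/

open FirstOrder

/-- A family of predicates on tuples from `{0, …, N}` that is defined by one first-order formula
with the numerical predicates. -/
def NumDef {α : Type} (P : ∀ N : ℕ, (α → Fin (N + 1)) → Prop) : Prop :=
  ∃ φ : numLang.Formula α, ∀ N v, φ.Realize v ↔ P N v

/-- A family of functions on tuples from `{0, …, N}` whose graph within `{0, …, N}` is defined by
one first-order formula with the numerical predicates. -/
def NumFun {α : Type} (f : ∀ N : ℕ, (α → Fin (N + 1)) → ℕ) : Prop :=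
  NumDef (α := α ⊕ Unit) fun N w => (w (.inr ()) : ℕ) = f N fun a => w (.inl a)

namespace NumDef

variable {α β : Type} {P Q : ∀ N : ℕ, (α → Fin (N + 1)) → Prop}

theorem congr (hP : NumDef P) (h : ∀ N v, Q N v ↔ P N v) : NumDef Q := by
  obtain ⟨φ, hφ⟩ := hP
  exact ⟨φ, fun N v => (hφ N v).trans (h N v).symm⟩

theorem relabel (hP : NumDef P) (f : α → β) : NumDef fun N (v : β → _) => P N fun a => v (f a) := by
  obtain ⟨φ, hφ⟩ := hP
  exact ⟨φ.relabel f, fun N v => by rw [Language.Formula.realize_relabel]; exact hφ N _⟩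

theorem of_true : NumDef (α := α) fun _ _ => True := ⟨⊤, fun N v => by simp⟩

theorem not (hP : NumDef P) : NumDef fun N v => ¬ P N v := by
  obtain ⟨φ, hφ⟩ := hP
  exact ⟨φ.not, fun N v => by rw [Language.Formula.realize_not, hφ]⟩

theorem and (hP : NumDef P) (hQ : NumDef Q) : NumDef fun N v => P N v ∧ Q N v := by
  obtain ⟨φ, hφ⟩ := hP
  obtain ⟨ψ, hψ⟩ := hQ
  exact ⟨φ ⊓ ψ, fun N v => by rw [Language.Formula.realize_inf, hφ, hψ]⟩

theorem or (hP : NumDef P) (hQ : NumDef Q) : NumDef fun N v => P N v ∨ Q N v :=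
  (hP.not.and hQ.not).not.congr fun N v => by tauto

theorem imp (hP : NumDef P) (hQ : NumDef Q) : NumDef fun N v => P N v → Q N v :=
  (hP.not.or hQ).congr fun N v => by tauto

theorem iff (hP : NumDef P) (hQ : NumDef Q) : NumDef fun N v => P N v ↔ Q N v :=
  ((hP.imp hQ).and (hQ.imp hP)).congr fun N v => by tauto

theorem ex {Q : ∀ N : ℕ, (α → Fin (N + 1)) → Fin (N + 1) → Prop}
    (hQ : NumDef (α := α ⊕ Unit) fun N w => Q N (fun a => w (.inl a)) (w (.inr ()))) :
    NumDef fun N v => ∃ z, Q N v z := by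
  obtain ⟨φ, hφ⟩ := hQ
  refine ⟨φ.iExs Unit, fun N v => ?_⟩
  rw [Language.Formula.realize_iExs]
  simp only [hφ, Sum.elim_inl, Sum.elim_inr]
  exact ⟨fun ⟨i, hi⟩ => ⟨i (), hi⟩, fun ⟨z, hz⟩ => ⟨fun _ => z, hz⟩⟩

theorem all {Q : ∀ N : ℕ, (α → Fin (N + 1)) → Fin (N + 1) → Prop}
    (hQ : NumDef (α := α ⊕ Unit) fun N w => Q N (fun a => w (.inl a)) (w (.inr ()))) :
    NumDef fun N v => ∀ z, Q N v z :=
  (ex (Q := fun N v z => ¬ Q N v z) hQ.not).not.congr fun N v => by simp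

theorem forall_finite {ι : Type} [Finite ι] {P : ι → ∀ N : ℕ, (α → Fin (N + 1)) → Prop}
    (hP : ∀ i, NumDef (P i)) : NumDef fun N v => ∀ i, P i N v := by
  choose φ hφ using hP
  refine ⟨Language.BoundedFormula.iInf φ, fun N v => ?_⟩
  rw [Language.Formula.Realize, Language.BoundedFormula.realize_iInf]
  exact forall_congr' fun i => hφ i N v

theorem exists_finite {ι : Type} [Finite ι] {P : ι → ∀ N : ℕ, (α → Fin (N + 1)) → Prop}
    (hP : ∀ i, NumDef (P i)) : NumDef fun N v => ∃ i, P i N v :=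
  (forall_finite fun i => (hP i).not).not.congr fun N v => by simp

theorem var_le (i j : α) : NumDef fun _ v => (v i : ℕ) ≤ v j :=
  ⟨Language.Relations.formula (L := numLang) (n := 2) NumRel.le ![.var i, .var j],
    fun _ _ => Iff.rfl⟩

theorem var_add (i j l : α) : NumDef fun _ v => (v i : ℕ) + v j = v l :=
  ⟨Language.Relations.formula (L := numLang) (n := 3) NumRel.add ![.var i, .var j, .var l],
    fun _ _ => Iff.rfl⟩

theorem var_mul (i j l : α) : NumDef fun _ v => (v i : ℕ) * v j = v l :=
  ⟨Language.Relations.formula (L := numLang) (n := 3) NumRel.mul ![.var i, .var j, .var l],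
    fun _ _ => Iff.rfl⟩

theorem var_bit (i j : α) : NumDef fun _ v => Nat.testBit (v j) (v i) = true :=
  ⟨Language.Relations.formula (L := numLang) (n := 2) NumRel.bit ![.var i, .var j],
    fun _ _ => Iff.rfl⟩

theorem var_eq_var (i j : α) : NumDef fun _ v => (v i : ℕ) = v j :=
  ((var_le i j).and (var_le j i)).congr fun _ _ => le_antisymm_iff

theorem var_lt (i j : α) : NumDef fun _ v => (v i : ℕ) < v j :=
  (var_le j i).not.congr fun _ _ => not_le.symm

theorem var_eq {f : ∀ N : ℕ, (α → Fin (N + 1)) → ℕ} (hf : NumFun f) (i : α) :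
    NumDef fun N v => (v i : ℕ) = f N v :=
  hf.relabel (Sum.elim id fun _ => i)

/-- Substitution of a function whose values are known to be in the range. -/
theorem subst {f : ∀ N : ℕ, (α → Fin (N + 1)) → ℕ} (hf : NumFun f)
    (hle : ∀ N v, f N v ≤ N) {Q : ∀ N : ℕ, (α → Fin (N + 1)) → ℕ → Prop}
    (hQ : NumDef (α := α ⊕ Unit) fun N w => Q N (fun a => w (.inl a)) (w (.inr ()))) :
    NumDef fun N v => Q N v (f N v) :=
  (ex (Q := fun N v z => (z : ℕ) = f N v ∧ Q N v z) (NumDef.and hf hQ)).congr fun N v =>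
    ⟨fun h => ⟨⟨f N v, Nat.lt_succ_of_le (hle N v)⟩, rfl, h⟩, fun ⟨_, h1, h2⟩ => h1 ▸ h2⟩

end NumDef

namespace NumFun

variable {α β : Type} {f f' : ∀ N : ℕ, (α → Fin (N + 1)) → ℕ}

theorem of_graph {Q : ∀ N : ℕ, (α → Fin (N + 1)) → Fin (N + 1) → Prop}
    (hQ : NumDef (α := α ⊕ Unit) fun N w => Q N (fun a => w (.inl a)) (w (.inr ())))
    (h : ∀ N v (z : Fin (N + 1)), (z : ℕ) = f N v ↔ Q N v z) : NumFun f :=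
  hQ.congr fun N _ => h N _ _

theorem relabel (hf : NumFun f) (e : α → β) :
    NumFun fun N (v : β → _) => f N fun a => v (e a) :=
  NumDef.relabel hf (Sum.map e id)

theorem var (i : α) : NumFun fun N (v : α → Fin (N + 1)) => (v i : ℕ) :=
  NumDef.var_eq_var _ _

theorem top : NumFun fun N (_ : α → Fin (N + 1)) => N :=
  of_graph (Q := fun N _ z => ∀ y : Fin (N + 1), (y : ℕ) ≤ z) (.all (.var_le _ _)) fun N v z =>
    ⟨fun h y => by rw [h]; exact Fin.is_le y, fun h => le_antisymm (Fin.is_le _) (h (Fin.last N))⟩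

theorem zero : NumFun fun N (_ : α → Fin (N + 1)) => 0 :=
  of_graph (Q := fun N _ z => ∀ y : Fin (N + 1), (z : ℕ) ≤ y) (.all (.var_le _ _)) fun N v z =>
    ⟨fun h y => by rw [h]; exact Nat.zero_le _, fun h => Nat.le_zero.mp (h 0)⟩

theorem one : NumFun fun N (_ : α → Fin (N + 1)) => 1 :=
  of_graph (Q := fun N _ z => ¬ (z : ℕ) = 0 ∧ ∀ y : Fin (N + 1), ¬ (y : ℕ) = 0 → (z : ℕ) ≤ y)
    (.and (NumDef.var_eq zero _).not (.all (.imp (NumDef.var_eq zero _).not (.var_le _ _))))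
    fun N v z => by
      constructor
      · intro h
        exact ⟨by omega, fun z hz => by omega⟩
      · rintro ⟨h0, h⟩
        have := h ⟨1, by omega⟩ (by simp)
        simp only at this
        omega

theorem add (hf : NumFun f) (hf' : NumFun f') : NumFun fun N v => f N v + f' N v :=
  of_graph (Q := fun N v z => ∃ a : Fin (N + 1), (a : ℕ) = f N v ∧
      ∃ b : Fin (N + 1), (b : ℕ) = f' N v ∧ (a : ℕ) + b = z)
    (.ex (.and (.var_eq (hf.relabel fun i => Sum.inl (Sum.inl i)) _)
      (.ex (.and (.var_eq (hf'.relabel fun i => Sum.inl (Sum.inl (Sum.inl i))) _)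
        (.var_add _ _ _))))) fun N v z => by
    constructor
    · intro h
      exact ⟨⟨f N v, by omega⟩, rfl, ⟨f' N v, by omega⟩, rfl, h.symm⟩
    · rintro ⟨a, ha, b, hb, h⟩
      rw [← h, ha, hb]

theorem eq_zero (hf : NumFun f) : NumDef fun N v => f N v = 0 :=
  (NumDef.ex (Q := fun N v z => (z : ℕ) = f N v ∧ (z : ℕ) = 0)
    (NumDef.and hf (NumDef.var_eq zero _))).congr fun N v =>
    ⟨fun h => ⟨0, by simp [h], rfl⟩, fun ⟨_, h1, h2⟩ => h1 ▸ h2⟩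

theorem mul (hf : NumFun f) (hf' : NumFun f') : NumFun fun N v => f N v * f' N v :=
  of_graph (Q := fun N v z => (∃ a : Fin (N + 1), (a : ℕ) = f N v ∧
      ∃ b : Fin (N + 1), (b : ℕ) = f' N v ∧ (a : ℕ) * b = z) ∨
      ((z : ℕ) = 0 ∧ (f N v = 0 ∨ f' N v = 0)))
    (.or (.ex (.and (.var_eq (hf.relabel fun i => Sum.inl (Sum.inl i)) _)
      (.ex (.and (.var_eq (hf'.relabel fun i => Sum.inl (Sum.inl (Sum.inl i))) _)
        (.var_mul _ _ _)))))
      (.and (.var_eq zero _) (.or (NumDef.relabel hf.eq_zero Sum.inl)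
        (NumDef.relabel hf'.eq_zero Sum.inl)))) fun N v z => by
    constructor
    · intro h
      rcases Nat.eq_zero_or_pos (f N v) with h0 | h0
      · exact .inr ⟨by rw [h, h0, zero_mul], .inl h0⟩
      rcases Nat.eq_zero_or_pos (f' N v) with h0' | h0'
      · exact .inr ⟨by rw [h, h0', mul_zero], .inr h0'⟩
      have h1 := Nat.le_mul_of_pos_right (f N v) h0'
      have h2 := Nat.le_mul_of_pos_left (f' N v) h0
      exact .inl ⟨⟨f N v, by omega⟩, rfl, ⟨f' N v, by omega⟩, rfl, h.symm⟩
    · rintro (⟨a, ha, b, hb, h⟩ | ⟨h0, h | h⟩)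
      · rw [← h, ha, hb]
      · rw [h0, h, zero_mul]
      · rw [h0, h, mul_zero]

theorem const (m : ℕ) : NumFun fun N (_ : α → Fin (N + 1)) => m := by
  induction m with
  | zero => exact zero
  | succ m ih => exact ih.add one

theorem pow (hf : NumFun f) (m : ℕ) : NumFun fun N v => f N v ^ m := by
  induction m with
  | zero => simpa using one
  | succ m ih => simpa only [pow_succ] using ih.mul hf

theorem testBit_log {x y : ℕ} (hx : x ≠ 0) :
    y = Nat.log 2 x ↔ Nat.testBit x y = true ∧ ∀ j, Nat.testBit x j = true → j ≤ y := by
  have h1 : Nat.testBit x (Nat.log 2 x) = true := by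
    rw [Nat.testBit_eq_decide_div_mod_eq, decide_eq_true_eq]
    have h2 := Nat.pow_log_le_self 2 hx
    have h3 := Nat.lt_pow_succ_log_self one_lt_two x
    have : x / 2 ^ Nat.log 2 x = 1 := by
      refine Nat.div_eq_of_lt_le (by omega) ?_
      rw [pow_succ] at h3
      omega
    rw [this]
  have h2 : ∀ j, Nat.testBit x j = true → j ≤ Nat.log 2 x := fun j hj =>
    Nat.le_log_of_pow_le one_lt_two (Nat.ge_two_pow_of_testBit hj)
  exact ⟨fun h => h ▸ ⟨h1, h2⟩, fun h => le_antisymm (h2 _ h.1) (h.2 _ h1)⟩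

theorem log_var (i : α) : NumFun fun N (v : α → Fin (N + 1)) => Nat.log 2 (v i) :=
  of_graph (Q := fun N v z => ((v i : ℕ) = 0 ∧ (z : ℕ) = 0) ∨ (¬ (v i : ℕ) = 0 ∧
      Nat.testBit (v i) z = true ∧ ∀ y : Fin (N + 1), Nat.testBit (v i) y = true → (y : ℕ) ≤ z))
    (.or (.and (.var_eq zero _) (.var_eq zero _)) (.and (NumDef.var_eq zero _).not
      (.and (.var_bit _ _) (.all (.imp (.var_bit _ _) (.var_le _ _)))))) fun N v z => by
      by_cases h0 : (v i : ℕ) = 0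
      · simp [h0]
      · rw [testBit_log h0]
        simp only [h0, false_and, not_false_eq_true, true_and, false_or]
        refine and_congr_right fun _ => ⟨fun h z => h z, fun h j hj => ?_⟩
        have h2 := Nat.ge_two_pow_of_testBit hj
        have h4 := Nat.lt_two_pow_self (n := j)
        exact h ⟨j, by omega⟩ hj

theorem log (hf : NumFun f) (hle : ∀ N v, f N v ≤ N) : NumFun fun N v => Nat.log 2 (f N v) :=
  NumDef.subst (α := α ⊕ Unit) (f := fun N v => f N fun a => v (Sum.inl a))
    (hf.relabel Sum.inl) (fun N _ => hle N _)
    (Q := fun _ v z => (v (Sum.inr ()) : ℕ) = Nat.log 2 z)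
    (NumDef.var_eq (log_var _) _)

theorem clog_two_succ {n : ℕ} (hn : 1 ≤ n) : Nat.clog 2 (n + 1) = Nat.log 2 n + 1 := by
  refine le_antisymm (Nat.clog_le_of_le_pow (Nat.lt_pow_succ_log_self one_lt_two n)) ?_
  rw [Nat.succ_le_iff, Nat.lt_clog_iff_pow_lt one_lt_two, Nat.lt_succ_iff]
  exact Nat.pow_log_le_self 2 (by omega)

theorem clog_var (i : α) : NumFun fun N (v : α → Fin (N + 1)) => Nat.clog 2 (v i) :=
  of_graph (Q := fun N v z => (((v i : ℕ) = 0 ∨ (v i : ℕ) = 1) ∧ (z : ℕ) = 0) ∨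
      ∃ y : Fin (N + 1), ¬ (y : ℕ) = 0 ∧ (v i : ℕ) = y + 1 ∧ (z : ℕ) = Nat.log 2 y + 1)
    (.or (.and (.or (.var_eq zero _) (.var_eq one _)) (.var_eq zero _))
      (.ex (.and (NumDef.var_eq zero _).not (.and (.var_eq ((var _).add one) _)
        (.var_eq ((log_var _).add one) _))))) fun N v z => by
    constructor
    · intro h
      rcases Nat.lt_or_ge (v i : ℕ) 2 with h2 | h2
      · refine .inl ⟨by omega, ?_⟩
        rw [h]
        exact Nat.clog_of_right_le_one (by omega) 2
      · refine .inr ⟨⟨v i - 1, by omega⟩, by simp only; omega, by simp only; omega, ?_⟩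
        rw [h, ← clog_two_succ (by simp only; omega)]
        congr 1
        simp only
        omega
    · rintro (⟨h1, h2⟩ | ⟨y, h0, h1, h2⟩)
      · rw [h2, Nat.clog_of_right_le_one (by omega)]
      · rw [h2, h1, clog_two_succ (by omega)]

end NumFun

/-! ### The circuit of the pebble game -/

namespace NumDef

variable {α : Type} {f f' : ∀ N : ℕ, (α → Fin (N + 1)) → ℕ}

theorem var_lt_fun (hf : NumFun f) (hle : ∀ N v, f N v ≤ N) (i : α) :
    NumDef fun N v => (v i : ℕ) < f N v :=
  subst hf hle (Q := fun _ v z => (v i : ℕ) < z) (var_lt _ _)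

theorem fun_eq_fun (hf : NumFun f) (hf' : NumFun f') (hle : ∀ N v, f N v ≤ N) :
    NumDef fun N v => f N v = f' N v :=
  subst hf hle (Q := fun N v z => z = f' N v) (var_eq (hf'.relabel Sum.inl) _)

end NumDef

namespace PebbleCircuit

/-- The largest `n` such that two Cayley tables of groups of order `n` fit into `N` bits. -/
def order (N : ℕ) : ℕ := Nat.findGreatest (fun n => 4 * (n * n * Nat.clog 2 n) ≤ N) N

/-- The number of binary digits of a table entry. -/
def digits (N : ℕ) : ℕ := Nat.clog 2 (order N)

/-- The number of bits of a table. -/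
def tableLength (N : ℕ) : ℕ := order N * order N * digits N

theorem four_mul_tableLength_le (N : ℕ) : 4 * tableLength N ≤ N :=
  Nat.findGreatest_spec (P := fun n => 4 * (n * n * Nat.clog 2 n) ≤ N) (Nat.zero_le N) (by simp)

theorem order_le (N : ℕ) : order N ≤ N := Nat.findGreatest_le N

theorem digits_le (N : ℕ) : digits N ≤ N :=
  (Nat.clog_le_of_le_pow Nat.lt_two_pow_self.le).trans (order_le N)

theorem numFun_order {α : Type} : NumFun fun N (_ : α → Fin (N + 1)) => order N :=
  NumFun.of_graph (Q := fun N _ z =>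
      (∃ u : Fin (N + 1), (u : ℕ) = 4 * (z * z * Nat.clog 2 z)) ∧
      ∀ y : Fin (N + 1), (∃ u : Fin (N + 1), (u : ℕ) = 4 * (y * y * Nat.clog 2 y)) → (y : ℕ) ≤ z)
    (have h {β : Type} (i : β) : NumDef fun N (v : β → Fin (N + 1)) =>
        ∃ u : Fin (N + 1), (u : ℕ) = 4 * (v i * v i * Nat.clog 2 (v i)) :=
      .ex (.var_eq ((NumFun.const 4).mul (((NumFun.var _).mul (.var _)).mul (.clog_var _))) _)
    .and (h _) (.all (.imp (h _) (.var_le _ _)))) fun N v z => by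
    have hiff (y : ℕ) : (∃ u : Fin (N + 1), (u : ℕ) = 4 * (y * y * Nat.clog 2 y)) ↔
        4 * (y * y * Nat.clog 2 y) ≤ N :=
      ⟨fun ⟨u, hu⟩ => hu ▸ Fin.is_le u, fun h => ⟨⟨_, Nat.lt_succ_of_le h⟩, rfl⟩⟩
    simp only [hiff]
    constructor
    · intro h
      rw [h]
      exact ⟨four_mul_tableLength_le N, fun y hy => Nat.le_findGreatest (Fin.is_le y) hy⟩
    · rintro ⟨h1, h2⟩
      exact le_antisymm (Nat.le_findGreatest (Fin.is_le z) h1)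
        (h2 ⟨order N, Nat.lt_succ_of_le (order_le N)⟩ (four_mul_tableLength_le N))

theorem numFun_digits {α : Type} : NumFun fun N (_ : α → Fin (N + 1)) => digits N :=
  NumDef.subst (α := α ⊕ Unit) (f := fun N _ => order N) numFun_order (fun N _ => order_le N)
    (Q := fun _ v z => (v (Sum.inr ()) : ℕ) = Nat.clog 2 z) (.var_eq (.clog_var _) _)

theorem numFun_tableLength {α : Type} : NumFun fun N (_ : α → Fin (N + 1)) => tableLength N :=
  (numFun_order.mul numFun_order).mul numFun_digits

/-- The coordinates of the names of gates. -/
inductive Coord (k : ℕ) : Type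
  | tag
  | round
  | pos
  | left (i : Fin 3)
  | right (i : Fin 3)
  | cur (j : Fin k)
  | resp (j : Fin k)
  | next (j : Fin k)

instance (k : ℕ) : Finite (Coord k) :=
  Finite.of_surjective (α := Fin 3 ⊕ (Fin 3 ⊕ Fin 3) ⊕ (Fin k ⊕ Fin k ⊕ Fin k))
    (Sum.elim ![.tag, .round, .pos] (Sum.elim (Sum.elim .left .right)
      (Sum.elim .cur (Sum.elim .resp .next)))) fun c => by
    cases c with
    | tag => exact ⟨.inl 0, rfl⟩
    | round => exact ⟨.inl 1, rfl⟩
    | pos => exact ⟨.inl 2, rfl⟩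
    | left i => exact ⟨.inr (.inl (.inl i)), rfl⟩
    | right i => exact ⟨.inr (.inl (.inr i)), rfl⟩
    | cur j => exact ⟨.inr (.inr (.inl j)), rfl⟩
    | resp j => exact ⟨.inr (.inr (.inr (.inl j))), rfl⟩
    | next j => exact ⟨.inr (.inr (.inr (.inr j))), rfl⟩

open Coord

/-- The gates. The tag tells the purpose of a gate: `0` output, `1` false, `2` input,
`3` negated input, `4` product in the second group, `5` clause (a product in the first group
implies a product in the second one), `6` position in the game, `7` move of the first player. -/
abbrev Name (k N : ℕ) : Type := Coord k → Fin (N + 1)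

variable {k N : ℕ}

/-- `h` is the gate for the literal which says that the `p`-th bit is `b`. -/
def IsLiteral (h : Name k N) (p : ℕ) (b : Prop) : Prop :=
  (h pos : ℕ) = p ∧ ¬ (h pos : ℕ) = N ∧ ((b ∧ (h tag : ℕ) = 2) ∨ (¬ b ∧ (h tag : ℕ) = 3))

def NegationWire (h g : Name k N) : Prop :=
  ¬ (g pos : ℕ) = N ∧ (h tag : ℕ) = 2 ∧ ∀ c, (c = tag → False) → (h c : ℕ) = g c

def ProductWire (h g : Name k N) : Prop :=
  ∃ b : Fin (N + 1), (b : ℕ) < digits N ∧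
    IsLiteral h (2 * (tableLength N + ((g (right 0) * order N + g (right 1)) * digits N + b)) + 1)
      (Nat.testBit (g (right 2)) b = true)

def ClauseWire (h g : Name k N) : Prop :=
  (∃ b : Fin (N + 1), (b : ℕ) < digits N ∧
    IsLiteral h (2 * ((g (left 0) * order N + g (left 1)) * digits N + b) + 1)
      (¬ Nat.testBit (g (left 2)) b = true)) ∨
  ((h tag : ℕ) = 4 ∧ ∀ i, (h (right i) : ℕ) = g (right i))

def PositionWire (h g : Name k N) : Prop :=
  ((h tag : ℕ) = 5 ∧ (∀ j, (g (cur j) : ℕ) < order N) ∧ ∃ i : Fin 3 → Fin k,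
    (∀ a, (h (left a) : ℕ) = g (cur (i a))) ∧ ∀ a, (h (right a) : ℕ) = g (resp (i a))) ∨
  ((h tag : ℕ) = 7 ∧ ¬ (g round : ℕ) = 0 ∧ (h round : ℕ) = g round ∧
    (∀ j, (h (cur j) : ℕ) = g (cur j)) ∧ (∀ j, (h (resp j) : ℕ) = g (resp j)) ∧
    ∀ j, (h (next j) : ℕ) < order N)

def MoveWire (t : ℕ) (h g : Name k N) : Prop :=
  (g round : ℕ) ≤ t ∧ (h tag : ℕ) = 6 ∧ (g round : ℕ) = h round + 1 ∧
    (∀ j, (h (cur j) : ℕ) = g (next j)) ∧ (∀ j, (h (resp j) : ℕ) < order N) ∧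
    (∀ j, (g (next j) : ℕ) = g (cur j) → (h (resp j) : ℕ) = g (resp j)) ∧
    ∀ i j, (g (next i) : ℕ) = g (next j) ↔ (h (resp i) : ℕ) = h (resp j)

def OutputWire (t : ℕ) (h : Name k N) : Prop :=
  ((h tag : ℕ) = 1 ∧ ¬ 0 = N ∧ ¬ 4 * tableLength N = N) ∨
  (∃ p : Fin (N + 1), (p : ℕ) < 2 * tableLength N ∧
    IsLiteral h (2 * p) (¬ (p : ℕ) < tableLength N)) ∨
  ((h tag : ℕ) = 6 ∧ (h round : ℕ) ≤ t ∧ ∀ j, (h (cur j) : ℕ) = N)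

def Wire (t : ℕ) (h g : Name k N) : Prop :=
  ((g tag : ℕ) = 0 ∧ OutputWire t h) ∨ ((g tag : ℕ) = 3 ∧ NegationWire h g) ∨
  ((g tag : ℕ) = 4 ∧ ProductWire h g) ∨ ((g tag : ℕ) = 5 ∧ ClauseWire h g) ∨
  ((g tag : ℕ) = 6 ∧ PositionWire h g) ∨ ((g tag : ℕ) = 7 ∧ MoveWire t h g)

/-- The kind of a gate. -/
def kind (g : Name k N) : GateKind N :=
  if (g tag : ℕ) = 2 then
    if h : (g pos : ℕ) < N then .input ⟨g pos, h⟩ else .and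
  else if (g tag : ℕ) = 3 ∧ ¬ (g pos : ℕ) = N then .not
  else if (g tag : ℕ) = 1 ∨ (g tag : ℕ) = 5 ∨ (g tag : ℕ) = 7 then .or
  else .and

theorem kind_eq_input_iff (g : Name k N) (i : Fin N) :
    kind g = .input i ↔ (g tag : ℕ) = 2 ∧ (g pos : ℕ) = i := by
  unfold kind
  constructor
  · intro h
    split_ifs at h with h1 h2
    injection h with h
    exact ⟨h1, by rw [← h]⟩
  · rintro ⟨h1, h2⟩
    rw [if_pos h1, dif_pos (h2 ▸ i.2)]
    congr 1
    exact Fin.ext h2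

theorem kind_eq_not_iff (g : Name k N) :
    kind g = .not ↔ (g tag : ℕ) = 3 ∧ ¬ (g pos : ℕ) = N := by
  unfold kind
  split_ifs <;> simp <;> omega

theorem kind_eq_or_iff (g : Name k N) :
    kind g = .or ↔ (g tag : ℕ) = 1 ∨ (g tag : ℕ) = 5 ∨ (g tag : ℕ) = 7 := by
  unfold kind
  split_ifs <;> simp <;> omega

theorem kind_eq_and_iff (g : Name k N) :
    kind g = .and ↔ ¬ ((g tag : ℕ) = 2 ∧ ¬ (g pos : ℕ) = N) ∧
      ¬ ((g tag : ℕ) = 3 ∧ ¬ (g pos : ℕ) = N) ∧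
      ¬ ((g tag : ℕ) = 1 ∨ (g tag : ℕ) = 5 ∨ (g tag : ℕ) = 7) := by
  have := (g pos).2
  unfold kind
  split_ifs <;> simp <;> omega

/-- The level of a gate. -/
def level (t : ℕ) (g : Name k N) : ℕ :=
  if (g tag : ℕ) = 0 then 2 * t + 5
  else if (g tag : ℕ) = 3 then 1
  else if (g tag : ℕ) = 4 then 2
  else if (g tag : ℕ) = 5 then 3
  else if (g tag : ℕ) = 6 then 2 * min (g round : ℕ) t + 4
  else if (g tag : ℕ) = 7 then 2 * min (g round : ℕ) t + 3
  else 0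

theorem level_le (t : ℕ) (g : Name k N) : level t g ≤ 2 * t + 5 := by
  unfold level
  split_ifs <;> omega

theorem IsLiteral.level_le {h : Name k N} {p : ℕ} {b : Prop} (hl : IsLiteral h p b) (t : ℕ) :
    level t h ≤ 1 := by
  obtain ⟨-, -, ⟨-, h⟩ | ⟨-, h⟩⟩ := hl <;> simp [level, h]

theorem level_lt_of_wire {t : ℕ} {h g : Name k N} (hw : Wire t h g) : level t h < level t g := by
  rcases hw with ⟨hg, hw⟩ | ⟨hg, hw⟩ | ⟨hg, hw⟩ | ⟨hg, hw⟩ | ⟨hg, hw⟩ | ⟨hg, hw⟩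
  · have hlev : level t g = 2 * t + 5 := by simp [level, hg]
    rcases hw with ⟨hh, -⟩ | ⟨p, -, hl⟩ | ⟨hh, hr, -⟩
    · have : level t h = 0 := by simp [level, hh]
      omega
    · have := hl.level_le t
      omega
    · have : level t h = 2 * min (h round : ℕ) t + 4 := by simp [level, hh]
      omega
  · simp [level, hg, hw.2.1]
  · obtain ⟨b, -, hl⟩ := hw
    have := hl.level_le t
    have hlev : level t g = 2 := by simp [level, hg]
    omega
  · have hlev : level t g = 3 := by simp [level, hg]
    rcases hw with ⟨b, -, hl⟩ | ⟨hh, -⟩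
    · have := hl.level_le t
      omega
    · have : level t h = 2 := by simp [level, hh]
      omega
  · have hlev : level t g = 2 * min (g round : ℕ) t + 4 := by simp [level, hg]
    rcases hw with ⟨hh, -⟩ | ⟨hh, -, hr, -⟩
    · have : level t h = 3 := by simp [level, hh]
      omega
    · have : level t h = 2 * min (h round : ℕ) t + 3 := by simp [level, hh]
      omega
  · have hlev : level t g = 2 * min (g round : ℕ) t + 3 := by simp [level, hg]
    have : level t h = 2 * min (h round : ℕ) t + 4 := by simp [level, hw.2.1]
    have h1 := hw.1
    have h2 := hw.2.2.1
    omega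

theorem wire_of_not {t : ℕ} {g : Name k N} (hg : kind g = .not) (h : Name k N) :
    Wire t h g ↔ NegationWire h g := by
  rw [kind_eq_not_iff] at hg
  simp [Wire, hg.1]

theorem existsUnique_negationWire {g : Name k N} (hg : kind g = .not) :
    ∃! h : Name k N, NegationWire h g := by
  classical
  rw [kind_eq_not_iff] at hg
  have hN : 2 < N + 1 := by have := (g tag).2; omega
  refine ⟨Function.update g tag ⟨2, hN⟩, ⟨hg.2, by simp, fun c hc => ?_⟩, fun h hh => ?_⟩
  · rw [Function.update_of_ne hc]
  · funext c
    by_cases hc : c = tag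
    · subst hc
      rw [Function.update_self]
      exact Fin.ext hh.2.1
    · rw [Function.update_of_ne hc]
      exact Fin.ext (hh.2.2 c hc)

/-- The circuit that plays the pebble game with `k` pebbles for `t` rounds. -/
def circuit (k N t : ℕ) : BoolCircuit N where
  Gate := Name k N
  finite_gate := inferInstance
  kind := kind
  wire := Wire t
  output := fun _ => 0
  acyclic := Subrelation.wf (fun hw => level_lt_of_wire hw) (InvImage.wf (level t) Nat.lt_wfRel.wf)
  input_source g i hg h hw := by
    rw [kind_eq_input_iff] at hg
    simp [Wire, hg.1] at hw
  not_unary g hg := by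
    simp only [wire_of_not hg]
    exact existsUnique_negationWire hg

theorem depthLE_circuit (k N t : ℕ) : (circuit k N t).DepthLE (2 * t + 5) :=
  ⟨level t, fun _ _ hw => level_lt_of_wire hw, level_le t⟩

theorem size_circuit (k N t : ℕ) :
    (circuit k N t).size = ((Polynomial.X + 1 : Polynomial ℕ) ^ Nat.card (Coord k)).eval N := by
  simp only [Polynomial.eval_pow, Polynomial.eval_add, Polynomial.eval_X, Polynomial.eval_one]
  change Nat.card (Coord k → Fin (N + 1)) = _
  rw [Nat.card_fun, Nat.card_eq_fintype_card, Fintype.card_fin]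

/-! Definability of the circuit -/

theorem numDef_isLiteral {α : Type} (e : Coord k → α) {p : ∀ N : ℕ, (α → Fin (N + 1)) → ℕ}
    (hp : NumFun p) {b : ∀ N : ℕ, (α → Fin (N + 1)) → Prop} (hb : NumDef b) :
    NumDef fun N v => IsLiteral (fun c => v (e c)) (p N v) (b N v) :=
  .and (.var_eq hp _) (.and (NumDef.var_eq .top _).not
    (.or (.and hb (.var_eq (.const 2) _)) (.and hb.not (.var_eq (.const 3) _))))

theorem two_mul_tableLength_le (N : ℕ) : 2 * tableLength N ≤ N := by
  have := four_mul_tableLength_le N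
  omega

theorem tableLength_le (N : ℕ) : tableLength N ≤ N := by
  have := four_mul_tableLength_le N
  omega

theorem numDef_lt_order {α : Type} (i : α) :
    NumDef fun N (v : α → Fin (N + 1)) => (v i : ℕ) < order N :=
  .var_lt_fun numFun_order (fun N _ => order_le N) i

theorem numDef_lt_digits {α : Type} (i : α) :
    NumDef fun N (v : α → Fin (N + 1)) => (v i : ℕ) < digits N :=
  .var_lt_fun numFun_digits (fun N _ => digits_le N) i

theorem numDef_negationWire : NumDef (α := Coord k ⊕ Coord k) fun N w =>
    NegationWire (N := N) (fun c => w (Sum.inl c)) (fun c => w (Sum.inr c)) :=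
  .and (NumDef.var_eq .top _).not (.and (.var_eq (.const 2) _)
    (.forall_finite fun c => by
      by_cases hc : c = tag
      · exact NumDef.of_true.congr fun N v => by simp [hc]
      · exact (NumDef.var_eq_var (Sum.inl c) (Sum.inr c)).congr fun N v => by simp [hc]))

theorem numDef_productWire : NumDef (α := Coord k ⊕ Coord k) fun N w =>
    ProductWire (N := N) (fun c => w (Sum.inl c)) (fun c => w (Sum.inr c)) :=
  .ex (.and (numDef_lt_digits _) (numDef_isLiteral (fun c => Sum.inl (Sum.inl c))
    (((NumFun.const 2).mul (numFun_tableLength.add (((((NumFun.var _).mul numFun_order).add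
      (.var _)).mul numFun_digits).add (.var _)))).add (.const 1)) (.var_bit _ _)))

theorem numDef_clauseWire : NumDef (α := Coord k ⊕ Coord k) fun N w =>
    ClauseWire (N := N) (fun c => w (Sum.inl c)) (fun c => w (Sum.inr c)) :=
  .or (.ex (.and (numDef_lt_digits _) (numDef_isLiteral (fun c => Sum.inl (Sum.inl c))
    (((NumFun.const 2).mul (((((NumFun.var _).mul numFun_order).add
      (.var _)).mul numFun_digits).add (.var _))).add (.const 1)) (NumDef.var_bit _ _).not)))
    (.and (.var_eq (.const 4) _) (.forall_finite fun _ => .var_eq_var _ _))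

theorem numDef_positionWire : NumDef (α := Coord k ⊕ Coord k) fun N w =>
    PositionWire (N := N) (fun c => w (Sum.inl c)) (fun c => w (Sum.inr c)) :=
  .or (.and (.var_eq (.const 5) _) (.and (.forall_finite fun _ => numDef_lt_order _)
    (.exists_finite fun _ => .and (.forall_finite fun _ => .var_eq_var _ _)
      (.forall_finite fun _ => .var_eq_var _ _))))
    (.and (.var_eq (.const 7) _) (.and (NumDef.var_eq .zero _).not (.and (.var_eq_var _ _)
      (.and (.forall_finite fun _ => .var_eq_var _ _) (.and (.forall_finite fun _ => .var_eq_var _ _)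
        (.forall_finite fun _ => numDef_lt_order _))))))

theorem numDef_le_rounds {t : ℕ → ℕ} (ht : NumDef (α := Unit) fun N v => (v () : ℕ) ≤ t N)
    {α : Type} (i : α) :
    NumDef fun N (v : α → Fin (N + 1)) => (v i : ℕ) ≤ t N :=
  ht.relabel fun _ => i

theorem numDef_moveWire {t : ℕ → ℕ} (ht : NumDef (α := Unit) fun N v => (v () : ℕ) ≤ t N) :
    NumDef (α := Coord k ⊕ Coord k) fun N w =>
      MoveWire (N := N) (t N) (fun c => w (Sum.inl c)) (fun c => w (Sum.inr c)) :=
  .and (numDef_le_rounds ht _) (.and (.var_eq (.const 6) _) (.and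
    (.var_eq ((NumFun.var _).add (.const 1)) _) (.and (.forall_finite fun _ => .var_eq_var _ _)
      (.and (.forall_finite fun _ => numDef_lt_order _)
        (.and (.forall_finite fun _ => .imp (.var_eq_var _ _) (.var_eq_var _ _))
          (.forall_finite fun _ => .forall_finite fun _ =>
            .iff (.var_eq_var _ _) (.var_eq_var _ _)))))))

theorem numDef_outputWire {t : ℕ → ℕ} (ht : NumDef (α := Unit) fun N v => (v () : ℕ) ≤ t N) :
    NumDef (α := Coord k ⊕ Coord k) fun N w =>
    OutputWire (N := N) (t N) (fun c => w (Sum.inl c)) :=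
  .or (.and (.var_eq (.const 1) _) (.and
      (NumDef.fun_eq_fun (.const 0) .top fun N _ => Nat.zero_le N).not
      (NumDef.fun_eq_fun ((NumFun.const 4).mul numFun_tableLength) .top
        fun N _ => four_mul_tableLength_le N).not))
    (.or (.ex (.and (.var_lt_fun ((NumFun.const 2).mul numFun_tableLength)
        (fun N _ => two_mul_tableLength_le N) _)
        (numDef_isLiteral (fun c => Sum.inl (Sum.inl c)) ((NumFun.const 2).mul (.var _))
          (NumDef.var_lt_fun numFun_tableLength (fun N _ => tableLength_le N) _).not)))
      (.and (.var_eq (.const 6) _) (.and (numDef_le_rounds ht _)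
        (.forall_finite fun _ => .var_eq .top _))))

theorem numDef_wire {t : ℕ → ℕ} (ht : NumDef (α := Unit) fun N v => (v () : ℕ) ≤ t N) :
    NumDef (α := Coord k ⊕ Coord k) fun N w =>
    Wire (N := N) (t N) (fun c => w (Sum.inl c)) (fun c => w (Sum.inr c)) :=
  .or (.and (.var_eq (.const 0) _) (numDef_outputWire ht)) (.or
    (.and (.var_eq (.const 3) _) numDef_negationWire) (.or
    (.and (.var_eq (.const 4) _) numDef_productWire) (.or
    (.and (.var_eq (.const 5) _) numDef_clauseWire) (.or
    (.and (.var_eq (.const 6) _) numDef_positionWire)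
    (.and (.var_eq (.const 7) _) (numDef_moveWire ht))))))

theorem foUniform_circuit {t : ℕ → ℕ} (ht : NumDef (α := Unit) fun N v => (v () : ℕ) ≤ t N)
    (k : ℕ) : FOUniform fun N => circuit k N (t N) := by
  let e := Finite.equivFin (Coord k)
  obtain ⟨isAnd, hAnd⟩ : NumDef fun N (v : Fin (Nat.card (Coord k)) → Fin (N + 1)) =>
      kind (fun c => v (e c)) = .and := by
    simp only [kind_eq_and_iff]
    exact .and (NumDef.and (.var_eq (.const 2) _) (NumDef.var_eq .top _).not).not
      (.and (NumDef.and (.var_eq (.const 3) _) (NumDef.var_eq .top _).not).not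
        (NumDef.or (.var_eq (.const 1) _) (.or (.var_eq (.const 5) _) (.var_eq (.const 7) _))).not)
  obtain ⟨isOr, hOr⟩ : NumDef fun N (v : Fin (Nat.card (Coord k)) → Fin (N + 1)) =>
      kind (fun c => v (e c)) = .or := by
    simp only [kind_eq_or_iff]
    exact NumDef.or (.var_eq (.const 1) _) (.or (.var_eq (.const 5) _) (.var_eq (.const 7) _))
  obtain ⟨isNot, hNot⟩ : NumDef fun N (v : Fin (Nat.card (Coord k)) → Fin (N + 1)) =>
      kind (fun c => v (e c)) = .not := by
    simp only [kind_eq_not_iff]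
    exact NumDef.and (.var_eq (.const 3) _) (NumDef.var_eq .top _).not
  obtain ⟨isInput, hInput⟩ : NumDef (α := Fin (Nat.card (Coord k)) ⊕ Unit) fun N v =>
      (v (.inl (e tag)) : ℕ) = 2 ∧ (v (.inl (e pos)) : ℕ) = v (.inr ()) :=
    .and (.var_eq (.const 2) _) (.var_eq_var _ _)
  obtain ⟨isOutput, hOutput⟩ : NumDef fun N (v : Fin (Nat.card (Coord k)) → Fin (N + 1)) =>
      ∀ i, (v i : ℕ) = 0 := .forall_finite fun _ => .var_eq .zero _
  obtain ⟨isWire, hWire⟩ := (numDef_wire (k := k) ht).relabel (Sum.map e e)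
  refine ⟨_, ⊤, isAnd, isOr, isNot, isOutput, isInput, isWire, fun N =>
    ⟨fun g i => g (e.symm i), fun g g' h => ?_, fun v => ?_, fun g => ?_, fun g => ?_, fun g => ?_,
      fun g i => ?_, fun g => ?_, fun h g => ?_⟩⟩
  · funext c
    simpa using congrFun h (e c)
  · simp only [Language.Formula.realize_top, iff_true]
    exact ⟨fun c => v (e c), by simp⟩
  · rw [hAnd]
    simp only [Equiv.symm_apply_apply]
    rfl
  · rw [hOr]
    simp only [Equiv.symm_apply_apply]
    rfl
  · rw [hNot]
    simp only [Equiv.symm_apply_apply]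
    rfl
  · rw [hInput]
    simp only [Sum.elim_inl, Sum.elim_inr, Equiv.symm_apply_apply, Fin.val_castSucc]
    exact kind_eq_input_iff g i
  · rw [hOutput]
    constructor
    · rintro rfl i
      rfl
    · intro h
      funext c
      have h0 : (g c : ℕ) = 0 := by simpa using h (e c)
      exact Fin.ext h0
  · rw [hWire]
    simp only [Sum.map_inl, Sum.map_inr, Sum.elim_inl, Sum.elim_inr, Equiv.symm_apply_apply]
    rfl

end PebbleCircuit

/-! ### The game played by the circuit -/

/-- The second player survives `T` rounds of the game in which the first player replaces, in each
round, the whole tuple `p` by a tuple `p'`, and the second player answers with a tuple `q'` that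
has the same equality type as `p'` and keeps the entries that the first player has kept. -/
def Survives {k : ℕ} {G H : Type*} [Group G] [Group H] :
    ℕ → (Fin k → G) → (Fin k → H) → Prop
  | 0, p, q => ∀ i j l, p i * p j = p l → q i * q j = q l
  | T + 1, p, q => (∀ i j l, p i * p j = p l → q i * q j = q l) ∧
    ∀ p' : Fin k → G, ∃ q' : Fin k → H, (∀ j, p' j = p j → q' j = q j) ∧
      (∀ i j, p' i = p' j ↔ q' i = q' j) ∧ Survives T p' q'

namespace Survives

variable {k : ℕ} {G H : Type*} [Group G] [Group H]

theorem mul {T : ℕ} {p : Fin k → G} {q : Fin k → H} (h : Survives T p q) (i j l : Fin k) :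
    p i * p j = p l → q i * q j = q l := by
  cases T with
  | zero => exact h i j l
  | succ T => exact h.1 i j l

theorem mono {T : ℕ} : ∀ {p : Fin k → G} {q : Fin k → H}, Survives (T + 1) p q →
    Survives T p q := by
  induction T with
  | zero => exact fun h => h.1
  | succ T ih =>
    intro p q h
    refine ⟨h.1, fun p' => ?_⟩
    obtain ⟨q', h1, h2, h3⟩ := h.2 p'
    exact ⟨q', h1, h2, ih h3⟩

theorem of_mulEquiv (φ : G ≃* H) (T : ℕ) : ∀ p : Fin k → G, Survives T p fun j => φ (p j) := by
  have hmul (p : Fin k → G) (i j l : Fin k) (h : p i * p j = p l) : φ (p i) * φ (p j) = φ (p l) := by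
    rw [← map_mul, h]
  induction T with
  | zero => exact hmul
  | succ T ih =>
    exact fun p => ⟨hmul p, fun p' => ⟨fun j => φ (p' j), fun j h => congrArg φ h,
      fun i j => φ.injective.eq_iff.symm, ih p'⟩⟩

/-- The game of tuples as a pebble game. -/
def game (k : ℕ) (G H : Type*) [Group G] [Group H] : PebbleGame k G H where
  rel T p q := (∀ i j, p i = p j ↔ q i = q j) ∧ Survives T p q
  mono h := ⟨h.1, h.2.mono⟩
  mul h := h.2.mul
  eq_iff h := h.1
  forth {T p q} h i x := by
    obtain ⟨q', h1, h2, h3⟩ := h.2.2 (Function.update p i x)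
    have hq : q' = Function.update q i (q' i) := by
      funext j
      by_cases hj : j = i
      · subst hj
        simp
      · rw [Function.update_of_ne hj]
        exact h1 j (Function.update_of_ne hj _ _)
    exact ⟨q' i, by rw [← hq]; exact ⟨h2, h3⟩⟩

theorem nonempty_mulEquiv [Finite G] [Finite H] {d : ℕ} (hd : Group.rank G ≤ d) {r : ℕ}
    (hr : derivedSeries G r = ⊥) (hcard : Nat.card G = Nat.card H)
    (h : ∀ p : Fin (d + 3) → G, ∃ q : Fin (d + 3) → H, (∀ i j, p i = p j ↔ q i = q j) ∧
      Survives (r * PebbleGame.layerRounds (Nat.card G) + 3) p q) : Nonempty (G ≃* H) := by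
  obtain ⟨g, hg⟩ := exists_generating_tuple hd
  obtain ⟨q, hq⟩ := h (Fin.append g fun _ => 1)
  have hrel : (game (d + 3) G H).rel _ (Fin.append g fun _ => 1) q := hq
  obtain ⟨φ, hφ, -⟩ := PebbleGame.exists_injective_hom (h := fun i => q (Fin.castAdd 3 i)) hg hr
    ⟨fun i => by simp, fun i => rfl⟩ hrel
  exact ⟨MulEquiv.ofBijective φ ((Nat.bijective_iff_injective_and_card φ).mpr ⟨hφ, hcard⟩)⟩

end Survives

namespace BoolCircuit

variable {N : ℕ} (C : BoolCircuit N) (x : Fin N → Bool) {g : C.Gate}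

theorem eval_input {i : Fin N} (hg : C.kind g = .input i) : C.eval x g ↔ x i = true := by
  rw [eval_eq, evalStep, hg]

theorem eval_and (hg : C.kind g = .and) : C.eval x g ↔ ∀ h, C.wire h g → C.eval x h := by
  rw [eval_eq, evalStep, hg]

theorem eval_or (hg : C.kind g = .or) : C.eval x g ↔ ∃ h, C.wire h g ∧ C.eval x h := by
  rw [eval_eq, evalStep, hg]
  simp

theorem eval_not (hg : C.kind g = .not) {h : C.Gate} (hw : C.wire h g) :
    C.eval x g ↔ ¬ C.eval x h := by
  rw [eval_eq, evalStep, hg]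
  refine ⟨fun H => H h hw, fun H h' hw' => ?_⟩
  rwa [(C.not_unary g hg).unique hw' hw]

end BoolCircuit

namespace PebbleCircuit

open Coord

variable {k N t : ℕ}

/-- The gate with the given coordinates. -/
def mkName (τ ρ p : Fin (N + 1)) (l r : Fin 3 → Fin (N + 1)) (c s n : Fin k → Fin (N + 1)) :
    Name k N
  | .tag => τ
  | .round => ρ
  | .pos => p
  | .left i => l i
  | .right i => r i
  | .cur j => c j
  | .resp j => s j
  | .next j => n j

theorem eval_literal (x : Fin N → Bool) {h : Name k N} {p : ℕ} {b : Prop} (hl : IsLiteral h p b)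
    (hp : p < N) : (circuit k N t).eval x h ↔ (x ⟨p, hp⟩ = true ↔ b) := by
  obtain ⟨rfl, -, ⟨hb, hh⟩ | ⟨hb, hh⟩⟩ := hl
  · have hk : (circuit k N t).kind h = .input ⟨h pos, hp⟩ := (kind_eq_input_iff h _).mpr ⟨hh, rfl⟩
    rw [(circuit k N t).eval_input x hk]
    simp [hb]
  · have hk : kind h = .not := (kind_eq_not_iff h).mpr ⟨hh, hp.ne⟩
    obtain ⟨h', hw, -⟩ := existsUnique_negationWire hk
    have hk' : (circuit k N t).kind h' = .input ⟨h pos, hp⟩ :=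
      (kind_eq_input_iff h' _).mpr ⟨hw.2.1, hw.2.2 pos (by simp)⟩
    rw [(circuit k N t).eval_not x (g := h) hk ((wire_of_not hk h').mpr hw),
      (circuit k N t).eval_input x hk']
    simp [hb]

theorem exists_isLiteral (k : ℕ) {p : ℕ} (hN : 3 ≤ N) (hp : p < N) (b : Prop) :
    ∃ h : Name k N, IsLiteral h p b := by
  by_cases hb : b
  · exact ⟨mkName ⟨2, by omega⟩ 0 ⟨p, by omega⟩ (fun _ => 0) (fun _ => 0) (fun _ => 0) (fun _ => 0)
      (fun _ => 0), rfl, hp.ne, .inl ⟨hb, rfl⟩⟩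
  · exact ⟨mkName ⟨3, by omega⟩ 0 ⟨p, by omega⟩ (fun _ => 0) (fun _ => 0) (fun _ => 0) (fun _ => 0)
      (fun _ => 0), rfl, hp.ne, .inr ⟨hb, rfl⟩⟩

theorem kind_eq_and_of_tag {g : Name k N} (hg : (g tag : ℕ) = 0 ∨ (g tag : ℕ) = 4 ∨ (g tag : ℕ) = 6) :
    (circuit k N t).kind g = .and := (kind_eq_and_iff g).mpr (by omega)

theorem kind_eq_or_of_tag {g : Name k N} (hg : (g tag : ℕ) = 1 ∨ (g tag : ℕ) = 5 ∨ (g tag : ℕ) = 7) :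
    (circuit k N t).kind g = .or := (kind_eq_or_iff g).mpr hg

/-- The bits of `x` from the position `s` on are, at the odd places, the Cayley table of a group
with the numbering `e`. -/
def IsTableAt {G : Type*} [Group G] (x : Fin N → Bool) (s : ℕ) (e : G ≃ Fin (order N)) : Prop :=
  ∀ a b, ∀ i < digits N, ∀ hp : 2 * (s + ((e a * order N + e b) * digits N + i)) + 1 < N,
    x ⟨_, hp⟩ = Nat.testBit (e (a * b)) i

theorem entry_lt {a b i : ℕ} (ha : a < order N) (hb : b < order N) (hi : i < digits N) :
    (a * order N + b) * digits N + i < tableLength N := by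
  have h1 : a * order N + b + 1 ≤ order N * order N := by nlinarith
  have h2 := Nat.mul_le_mul_right (digits N) h1
  rw [tableLength]
  linarith

theorem eq_iff_testBit {u v : ℕ} (hu : u < order N) (hv : v < order N) :
    u = v ↔ ∀ i < digits N, (Nat.testBit u i = true ↔ Nat.testBit v i = true) := by
  have hle : order N ≤ 2 ^ digits N := Nat.le_pow_clog one_lt_two _
  refine ⟨fun h i _ => by rw [h], fun h => Nat.eq_of_testBit_eq fun i => ?_⟩
  rcases Nat.lt_or_ge i (digits N) with hi | hi
  · exact Bool.eq_iff_iff.mpr (h i hi)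
  · have : 2 ^ digits N ≤ 2 ^ i := Nat.pow_le_pow_right two_pos hi
    rw [Nat.testBit_lt_two_pow (by omega), Nat.testBit_lt_two_pow (by omega)]

theorem mul_eq_iff_of_isTableAt {G : Type*} [Group G] {x : Fin N → Bool} {s : ℕ}
    {e : G ≃ Fin (order N)} (hx : IsTableAt x s e) (hs : 2 * (s + tableLength N) ≤ N) (a b c : G) :
    a * b = c ↔ ∀ i < digits N, ∀ hp, (x ⟨2 * (s + ((e a * order N + e b) * digits N + i)) + 1, hp⟩
      = true ↔ Nat.testBit (e c) i = true) := by
  rw [← e.injective.eq_iff, Fin.ext_iff, eq_iff_testBit (e _).2 (e _).2]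
  refine forall₂_congr fun i hi => ?_
  have hp := entry_lt (e a).2 (e b).2 hi
  refine ⟨fun h hp => by rw [hx a b i hi]; exact h, fun h => ?_⟩
  rw [← hx a b i hi (by omega)]
  exact h _

section

variable {G H : Type*} [Group G] [Group H] {x : Fin N → Bool} {e : G ≃ Fin (order N)}
  {f : H ≃ Fin (order N)}

theorem eval_product (hN : 4 * tableLength N = N) (h8 : 8 ≤ N)
    (hf : IsTableAt x (tableLength N) f) {g : Name k N} (hg : (g tag : ℕ) = 4) {v : Fin 3 → H}
    (hv : ∀ i, (g (right i) : ℕ) = f (v i)) :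
    (circuit k N t).eval x g ↔ v 0 * v 1 = v 2 := by
  rw [(circuit k N t).eval_and x (kind_eq_and_of_tag (.inr (.inl hg))),
    mul_eq_iff_of_isTableAt hf (by omega)]
  have hw (h : Name k N) : (circuit k N t).wire h g ↔ ProductWire h g := by
    change Wire t h g ↔ _
    simp [Wire, hg]
  constructor
  · intro hall i hi hp
    obtain ⟨h, hl⟩ := exists_isLiteral k (by omega) hp (Nat.testBit (f (v 2)) i = true)
    rw [← eval_literal x hl hp]
    refine hall h ((hw h).mpr ⟨⟨i, by have := digits_le N; omega⟩, hi, ?_⟩)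
    rw [hv, hv, hv]
    exact hl
  · intro hall h hwire
    obtain ⟨i, hi, hl⟩ := (hw h).mp hwire
    rw [hv, hv, hv] at hl
    have hp := entry_lt (f (v 0)).2 (f (v 1)).2 hi
    rw [eval_literal x hl (by omega)]
    exact hall i hi _

theorem eval_clause (hN : 4 * tableLength N = N) (h8 : 8 ≤ N) (he : IsTableAt x 0 e)
    (hf : IsTableAt x (tableLength N) f) {g : Name k N} (hg : (g tag : ℕ) = 5) {u : Fin 3 → G}
    {v : Fin 3 → H} (hu : ∀ i, (g (left i) : ℕ) = e (u i)) (hv : ∀ i, (g (right i) : ℕ) = f (v i)) :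
    (circuit k N t).eval x g ↔ (u 0 * u 1 = u 2 → v 0 * v 1 = v 2) := by
  rw [(circuit k N t).eval_or x (kind_eq_or_of_tag (.inr (.inl hg))),
    mul_eq_iff_of_isTableAt he (by omega)]
  have hw (h : Name k N) : (circuit k N t).wire h g ↔ ClauseWire h g := by
    change Wire t h g ↔ _
    simp [Wire, hg]
  constructor
  · rintro ⟨h, hwire, hev⟩ hall
    rcases (hw h).mp hwire with ⟨i, hi, hl⟩ | ⟨hh, hr⟩
    · rw [hu, hu, hu] at hl
      have hp := entry_lt (e (u 0)).2 (e (u 1)).2 hi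
      rw [eval_literal x hl (by omega)] at hev
      have := hall i hi (by omega)
      simp only [Nat.zero_add] at this
      tauto
    · exact (eval_product hN h8 hf hh fun i => (hr i).trans (hv i)).mp hev
  · intro himp
    by_cases hall : v 0 * v 1 = v 2
    · have hh : ((mkName ⟨4, by omega⟩ 0 0 (fun _ => 0) (fun i => g (right i)) (fun _ => 0)
        (fun _ => 0) (fun _ => 0) : Name k N) tag : ℕ) = 4 := rfl
      exact ⟨_, (hw _).mpr (.inr ⟨hh, fun i => rfl⟩), (eval_product hN h8 hf hh hv).mpr hall⟩
    · have := mt himp hall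
      push Not at this
      obtain ⟨i, hi, hp, hne⟩ := this
      simp only [Nat.zero_add] at hp hne
      obtain ⟨h, hl⟩ := exists_isLiteral k (by omega) hp (¬ Nat.testBit (e (u 2)) i = true)
      refine ⟨h, (hw h).mpr (.inl ⟨⟨i, by have := digits_le N; omega⟩, hi, ?_⟩), ?_⟩
      · rw [hu, hu, hu]
        exact hl
      · rw [eval_literal x hl hp]
        tauto

/-- The circuit evaluates positions with `T` rounds to go correctly. -/
def EvaluatesPositions (t T : ℕ) (x : Fin N → Bool) (k : ℕ) (e : G ≃ Fin (order N))
    (f : H ≃ Fin (order N)) : Prop :=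
  ∀ (g : Name k N) (p : Fin k → G) (q : Fin k → H), (g tag : ℕ) = 6 → (g round : ℕ) = T →
    (∀ j, (g (cur j) : ℕ) = e (p j)) → (∀ j, (g (resp j) : ℕ) = f (q j)) →
    ((circuit k N t).eval x g ↔ Survives T p q)

theorem eval_move (h8 : 8 ≤ N) {T : ℕ} (hpos : EvaluatesPositions t T x k e f) (hT : T + 1 ≤ t)
    {g : Name k N} (hg : (g tag : ℕ) = 7) (hr : (g round : ℕ) = T + 1) {p' : Fin k → G}
    (hp' : ∀ j, (g (next j) : ℕ) = e (p' j)) :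
    (circuit k N t).eval x g ↔ ∃ q' : Fin k → H,
      (∀ j, (e (p' j) : ℕ) = g (cur j) → (f (q' j) : ℕ) = g (resp j)) ∧
      (∀ i j, p' i = p' j ↔ q' i = q' j) ∧ Survives T p' q' := by
  rw [(circuit k N t).eval_or x (kind_eq_or_of_tag (.inr (.inr hg)))]
  have hw (h : Name k N) : (circuit k N t).wire h g ↔ MoveWire t h g := by
    change Wire t h g ↔ _
    simp [Wire, hg]
  constructor
  · rintro ⟨h, hwire, hev⟩
    obtain ⟨-, hh, hrr, hcur, hlt, hagree, heq⟩ := (hw h).mp hwire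
    have hq (j : Fin k) : (h (resp j) : ℕ) = f (f.symm ⟨h (resp j), hlt j⟩) := by simp
    refine ⟨fun j => f.symm ⟨h (resp j), hlt j⟩, fun j hj => ?_, fun i j => ?_, ?_⟩
    · rw [← hq]
      exact hagree j ((hp' j).trans hj)
    · rw [← e.injective.eq_iff, Fin.ext_iff, ← hp', ← hp', heq]
      simp
    · exact (hpos h p' _ hh (by omega) (fun j => (hcur j).trans (hp' j)) hq).mp hev
  · rintro ⟨q', hagree, heq, hS⟩
    have hlt (j : Fin k) : (f (q' j) : ℕ) < N + 1 := by
      have := (f (q' j)).2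
      have := order_le N
      omega
    have hTlt : T < N + 1 := by have := (g round).2; omega
    refine ⟨mkName ⟨6, by omega⟩ ⟨T, hTlt⟩ 0 (fun _ => 0) (fun _ => 0) (fun j => g (next j))
      (fun j => ⟨f (q' j), hlt j⟩) (fun _ => 0), (hw _).mpr ⟨by omega, rfl, hr, fun j => rfl,
      fun j => (f (q' j)).2, fun j hj => hagree j ((hp' j).symm.trans hj), fun i j => ?_⟩, ?_⟩
    · rw [hp', hp', ← Fin.ext_iff, e.injective.eq_iff, heq]
      exact (Fin.ext_iff.symm.trans f.injective.eq_iff).symm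
    · exact (hpos _ p' q' rfl rfl hp' fun j => rfl).mpr hS

theorem position_wire_iff {g : Name k N} (hg : (g tag : ℕ) = 6) (h : Name k N) :
    (circuit k N t).wire h g ↔ PositionWire h g := by
  change Wire t h g ↔ _
  simp [Wire, hg]

theorem evaluatesPositions (hN : 4 * tableLength N = N) (h8 : 8 ≤ N) (he : IsTableAt x 0 e)
    (hf : IsTableAt x (tableLength N) f) (T : ℕ) (hT : T ≤ t) :
    EvaluatesPositions t T x k e f := by
  have hval {K : Type _} (e : K ≃ Fin (order N)) (a : K) : (e a : ℕ) < N + 1 := by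
    have := (e a).2
    have := order_le N
    omega
  have hclauses (g : Name k N) (p : Fin k → G) (q : Fin k → H) (hg : (g tag : ℕ) = 6)
      (hp : ∀ j, (g (cur j) : ℕ) = e (p j)) (hq : ∀ j, (g (resp j) : ℕ) = f (q j)) :
      (∀ h : Name k N, (h tag : ℕ) = 5 → PositionWire h g → (circuit k N t).eval x h) ↔
        ∀ i j l, p i * p j = p l → q i * q j = q l := by
    constructor
    · intro hall i j l
      have hh : ((mkName ⟨5, by omega⟩ 0 0 (fun a => g (cur (![i, j, l] a)))
        (fun a => g (resp (![i, j, l] a))) (fun _ => 0) (fun _ => 0) (fun _ => 0) : Name k N) tag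
        : ℕ) = 5 := rfl
      exact (eval_clause hN h8 he hf hh (u := fun a => p (![i, j, l] a))
        (v := fun a => q (![i, j, l] a)) (fun a => hp _) (fun a => hq _)).mp
        (hall _ hh (.inl ⟨hh, fun j => by rw [hp]; exact (e (p j)).2, ![i, j, l], fun a => rfl,
          fun a => rfl⟩))
    · rintro hall h hh (⟨-, -, i, hl, hr⟩ | ⟨hh', -⟩)
      · exact (eval_clause hN h8 he hf hh (u := fun a => p (i a)) (v := fun a => q (i a))
          (fun a => (hl a).trans (hp _)) (fun a => (hr a).trans (hq _))).mpr (hall _ _ _)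
      · omega
  induction T with
  | zero =>
    intro g p q hg hr hp hq
    rw [(circuit k N t).eval_and x (kind_eq_and_of_tag (.inr (.inr hg)))]
    refine Iff.trans ⟨fun hall h _ hwire => hall h ((position_wire_iff hg h).mpr hwire),
      fun hall h hwire => ?_⟩ (hclauses g p q hg hp hq)
    rcases (position_wire_iff hg h).mp hwire with hc | hm
    · exact hall h hc.1 (.inl hc)
    · exact absurd hr hm.2.1
  | succ T ih =>
    intro g p q hg hr hp hq
    rw [(circuit k N t).eval_and x (kind_eq_and_of_tag (.inr (.inr hg)))]
    have hmoves (h : Name k N) (hm : (h tag : ℕ) = 7) (hw : PositionWire h g) (p' : Fin k → G)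
        (hp' : ∀ j, (h (next j) : ℕ) = e (p' j)) : (circuit k N t).eval x h ↔
          ∃ q' : Fin k → H, (∀ j, p' j = p j → q' j = q j) ∧
            (∀ i j, p' i = p' j ↔ q' i = q' j) ∧ Survives T p' q' := by
      rcases hw with ⟨h5, -⟩ | ⟨-, -, hr', hc, hs, -⟩
      · omega
      · rw [eval_move h8 (ih (by omega)) hT hm (hr'.trans hr) hp']
        simp only [hc, hs, hp, hq, ← Fin.ext_iff, e.injective.eq_iff, f.injective.eq_iff]
    constructor
    · intro hall
      refine ⟨(hclauses g p q hg hp hq).mp fun h _ hwire =>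
        hall h ((position_wire_iff hg h).mpr hwire), fun p' => ?_⟩
      let h : Name k N := mkName ⟨7, by omega⟩ (g round) 0 (fun _ => 0) (fun _ => 0)
        (fun j => g (cur j)) (fun j => g (resp j)) (fun j => ⟨e (p' j), hval e _⟩)
      have hwire : PositionWire h g := .inr ⟨rfl, by omega, rfl, fun j => rfl, fun j => rfl,
        fun j => (e (p' j)).2⟩
      exact (hmoves h rfl hwire p' fun j => rfl).mp (hall h ((position_wire_iff hg h).mpr hwire))
    · rintro ⟨hmul, hall⟩ h hwire
      rw [position_wire_iff hg h] at hwire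
      rcases hwire with hc | hm
      · exact (hclauses g p q hg hp hq).mpr hmul h hc.1 (.inl hc)
      · have hlt := hm.2.2.2.2.2
        exact (hmoves h hm.1 (.inr hm) (fun j => e.symm ⟨h (next j), hlt j⟩) fun j => by simp).mpr
          (hall _)

theorem output_wire_iff (h : Name k N) :
    (circuit k N t).wire h (circuit k N t).output ↔ OutputWire t h := by
  change Wire t h (fun _ => 0) ↔ _
  simp [Wire]

theorem accepts_iff_wires (x : Fin N → Bool) : (circuit k N t).Accepts x ↔
    ∀ h : Name k N, OutputWire t h → (circuit k N t).eval x h :=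
  ((circuit k N t).eval_and x (kind_eq_and_of_tag (.inl rfl))).trans
    (forall_congr' fun h => imp_congr (output_wire_iff h) Iff.rfl)

theorem accepts_of_length_zero (x : Fin 0 → Bool) : (circuit k 0 t).Accepts x := by
  rw [accepts_iff_wires]
  rintro h (⟨hh, -⟩ | ⟨p, hp, -⟩ | ⟨hh, -⟩)
  · have := (h tag).2
    omega
  · have := four_mul_tableLength_le 0
    omega
  · have := (h tag).2
    omega

theorem four_mul_tableLength_of_accepts (hN : N ≠ 0) {x : Fin N → Bool}
    (hx : (circuit k N t).Accepts x) : 4 * tableLength N = N := by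
  by_contra hne
  rw [accepts_iff_wires] at hx
  let h : Name k N := mkName ⟨1, by omega⟩ 0 0 (fun _ => 0) (fun _ => 0) (fun _ => 0) (fun _ => 0)
    (fun _ => 0)
  have hev := hx h (.inl ⟨rfl, hN.symm, hne⟩)
  rw [(circuit k N t).eval_or x (kind_eq_or_of_tag (.inl rfl))] at hev
  obtain ⟨h', hw, -⟩ := hev
  have hw' : Wire t h' h := hw
  simp [Wire, h, mkName] at hw'

theorem tag_of_accepts (h8 : 8 ≤ N) {x : Fin N → Bool} (hx : (circuit k N t).Accepts x) {p : ℕ}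
    (hp : p < 2 * tableLength N) (hpN : 2 * p < N) :
    x ⟨2 * p, hpN⟩ = true ↔ ¬ p < tableLength N := by
  rw [accepts_iff_wires] at hx
  obtain ⟨h, hl⟩ := exists_isLiteral k (by omega) hpN (¬ p < tableLength N)
  exact (eval_literal x hl hpN).mp (hx h (.inr (.inl ⟨⟨p, by omega⟩, hp, hl⟩)))

theorem accepts_iff (hk : 0 < k) (htN : t ≤ N) (hN : 4 * tableLength N = N) (h8 : 8 ≤ N)
    (htags : ∀ p < 2 * tableLength N, ∀ hp : 2 * p < N, x ⟨2 * p, hp⟩ = true ↔ ¬ p < tableLength N)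
    (he : IsTableAt x 0 e) (hf : IsTableAt x (tableLength N) f) :
    (circuit k N t).Accepts x ↔ ∀ T < t, ∀ p : Fin k → G, ∃ q : Fin k → H,
      (∀ i j, p i = p j ↔ q i = q j) ∧ Survives T p q := by
  have hmoves (T : ℕ) (hT : T < t) (h : Name k N) (hm : (h tag : ℕ) = 7) (hr : (h round : ℕ) = T + 1)
      (hc : ∀ j, (h (cur j) : ℕ) = N) (p : Fin k → G)
      (hp : ∀ j, (h (next j) : ℕ) = e (p j)) : (circuit k N t).eval x h ↔
        ∃ q : Fin k → H, (∀ i j, p i = p j ↔ q i = q j) ∧ Survives T p q := by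
    rw [eval_move h8 (evaluatesPositions hN h8 he hf T hT.le) hT hm hr hp]
    refine exists_congr fun q => and_iff_right fun j hj => ?_
    rw [hc] at hj
    have := (e (p j)).2
    have := order_le N
    omega
  rw [accepts_iff_wires]
  constructor
  · intro hall T hT p
    let g : Name k N := mkName ⟨6, by omega⟩ ⟨T + 1, by omega⟩ 0 (fun _ => 0) (fun _ => 0)
      (fun _ => Fin.last N) (fun _ => 0) (fun _ => 0)
    have hg := hall g (.inr (.inr ⟨rfl, hT, fun j => rfl⟩))
    rw [(circuit k N t).eval_and x (kind_eq_and_of_tag (.inr (.inr rfl)))] at hg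
    let h : Name k N := mkName ⟨7, by omega⟩ ⟨T + 1, by omega⟩ 0 (fun _ => 0) (fun _ => 0)
      (fun _ => Fin.last N) (fun _ => 0)
      (fun j => ⟨e (p j), by have := (e (p j)).2; have := order_le N; omega⟩)
    exact (hmoves T hT h rfl rfl (fun j => rfl) p fun j => rfl).mp (hg h
      ((position_wire_iff rfl h).mpr (.inr ⟨rfl, Nat.succ_ne_zero T, rfl, fun j => rfl,
        fun j => rfl, fun j => (e (p j)).2⟩)))
  · rintro hall g (⟨-, -, hne⟩ | ⟨p, hp, hl⟩ | ⟨hg, hr, hc⟩)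
    · exact absurd hN hne
    · rw [eval_literal x hl (by omega)]
      exact htags p hp (by omega)
    · rw [(circuit k N t).eval_and x (kind_eq_and_of_tag (.inr (.inr hg)))]
      intro h hwire
      rw [position_wire_iff hg h] at hwire
      rcases hwire with ⟨-, hlt, -⟩ | ⟨hh, hr0, hrr, hcc, -, hlt⟩
      · have := hlt ⟨0, hk⟩
        rw [hc] at this
        have := order_le N
        omega
      · obtain ⟨T, hT⟩ := Nat.exists_eq_succ_of_ne_zero hr0
        exact (hmoves T (by omega) h hh (hrr.trans hT) (fun j => (hcc j).trans (hc j))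
          (fun j => e.symm ⟨h (next j), hlt j⟩) fun j => by simp).mpr (hall T (by omega) _)

end

end PebbleCircuit

/-! ### The circuit on encodings of pairs of groups -/

section Strings

theorem length_flatMap_tag (c : Bool) (l : List Bool) :
    (l.flatMap fun b => [c, b]).length = 2 * l.length := by
  induction l with
  | nil => rfl
  | cons b l ih => simp only [List.flatMap_cons, List.length_append, ih, List.length_cons,
      List.length_nil]; omega

theorem getElem?_flatMap_tag_even (c : Bool) (l : List Bool) {p : ℕ} (hp : p < l.length) :
    (l.flatMap fun b => [c, b])[2 * p]? = some c := by
  induction l generalizing p with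
  | nil => simp at hp
  | cons b l ih =>
    cases p with
    | zero => simp
    | succ p =>
      rw [show 2 * (p + 1) = 2 * p + 1 + 1 by ring]
      simpa using ih (by simpa using hp)

theorem getElem?_flatMap_tag_odd (c : Bool) (l : List Bool) (p : ℕ) :
    (l.flatMap fun b => [c, b])[2 * p + 1]? = l[p]? := by
  induction l generalizing p with
  | nil => simp
  | cons b l ih =>
    cases p with
    | zero => simp
    | succ p =>
      rw [show 2 * (p + 1) + 1 = 2 * p + 1 + 1 + 1 by ring]
      simpa using ih p

theorem length_pairString (x y : List Bool) :
    (pairString x y).length = 2 * (x.length + y.length) := by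
  rw [pairString, List.length_append, length_flatMap_tag, length_flatMap_tag, mul_add]

theorem getElem?_pairString_even (x y : List Bool) {p : ℕ} (hp : p < x.length + y.length) :
    (pairString x y)[2 * p]? = some (decide (x.length ≤ p)) := by
  rw [pairString]
  rcases Nat.lt_or_ge p x.length with h | h
  · rw [List.getElem?_append_left (by rw [length_flatMap_tag]; omega),
      getElem?_flatMap_tag_even _ _ h, decide_eq_false (by omega)]
  · rw [List.getElem?_append_right (by rw [length_flatMap_tag]; omega), length_flatMap_tag,
      ← Nat.mul_sub, getElem?_flatMap_tag_even _ _ (by omega), decide_eq_true h]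

theorem getElem?_pairString_odd_left (x y : List Bool) {p : ℕ} (hp : p < x.length) :
    (pairString x y)[2 * p + 1]? = x[p]? := by
  rw [pairString, List.getElem?_append_left (by rw [length_flatMap_tag]; omega),
    getElem?_flatMap_tag_odd]

theorem getElem?_pairString_odd_right (x y : List Bool) (p : ℕ) :
    (pairString x y)[2 * (x.length + p) + 1]? = y[p]? := by
  rw [pairString, List.getElem?_append_right (by rw [length_flatMap_tag]; omega),
    length_flatMap_tag, show 2 * (x.length + p) + 1 - 2 * x.length = 2 * p + 1 by omega,
    getElem?_flatMap_tag_odd]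

theorem length_cayleyString {G : Type*} [Group G] {n : ℕ} (e : G ≃ Fin n) :
    (cayleyString e).length = n * n * Nat.clog 2 n := List.length_ofFn

theorem getElem?_cayleyString {G : Type*} [Group G] {n : ℕ} (e : G ≃ Fin n) (a b : G) {i : ℕ}
    (hi : i < Nat.clog 2 n) :
    (cayleyString e)[(e a * n + e b) * Nat.clog 2 n + i]? =
      some (Nat.testBit (e (a * b)) i) := by
  have hlt : (e a * n + e b) * Nat.clog 2 n + i < n * n * Nat.clog 2 n := by
    have h1 : (e a : ℕ) * n + e b + 1 ≤ n * n := by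
      have := (e a).2
      have := (e b).2
      nlinarith
    have h2 := Nat.mul_le_mul_right (Nat.clog 2 n) h1
    linarith
  have hc : 0 < Nat.clog 2 n := by omega
  have hn : 0 < n := (Nat.zero_le _).trans_lt (e a).2
  have hdiv : ((e a * n + e b) * Nat.clog 2 n + i) / Nat.clog 2 n = e a * n + e b := by
    rw [mul_comm, Nat.mul_add_div hc, Nat.div_eq_of_lt hi, add_zero]
  have h1 : (⟨_, hlt⟩ : Fin (n * n * Nat.clog 2 n)).divNat.divNat = e a := by
    ext
    simp only [Fin.coe_divNat, hdiv]
    rw [mul_comm, Nat.mul_add_div hn, Nat.div_eq_of_lt (e b).2, add_zero]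
  have h2 : (⟨_, hlt⟩ : Fin (n * n * Nat.clog 2 n)).divNat.modNat = e b := by
    ext
    simp only [Fin.coe_divNat, Fin.coe_modNat, hdiv]
    rw [mul_comm, Nat.mul_add_mod, Nat.mod_eq_of_lt (e b).2]
  have h3 : ((⟨_, hlt⟩ : Fin (n * n * Nat.clog 2 n)).modNat : ℕ) = i := by
    simp only [Fin.coe_modNat]
    rw [mul_comm, Nat.mul_add_mod, Nat.mod_eq_of_lt hi]
  rw [cayleyString, List.getElem?_ofFn, dif_pos hlt, h1, h2, h3, e.symm_apply_apply,
    e.symm_apply_apply]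

end Strings

namespace PebbleCircuit

theorem table_size_lt {n m : ℕ} (hn : 1 ≤ n) (h : n < m) :
    n * n * Nat.clog 2 n < m * m * Nat.clog 2 m := by
  have hc : 0 < Nat.clog 2 m := Nat.clog_pos one_lt_two (by omega)
  calc n * n * Nat.clog 2 n ≤ n * n * Nat.clog 2 m :=
        Nat.mul_le_mul_left _ (Nat.clog_mono_right 2 h.le)
    _ < m * m * Nat.clog 2 m := Nat.mul_lt_mul_of_pos_right (by nlinarith) hc

theorem table_size_injective {n m : ℕ} (hn : 1 ≤ n) (hm : 1 ≤ m)
    (h : n * n * Nat.clog 2 n = m * m * Nat.clog 2 m) : n = m := by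
  rcases lt_trichotomy n m with hlt | heq | hlt
  · exact absurd h (table_size_lt hn hlt).ne
  · exact heq
  · exact absurd h (table_size_lt hm hlt).ne'

theorem four_le_table_size {n : ℕ} (hn : 2 ≤ n) : 4 ≤ n * n * Nat.clog 2 n := by
  have hc : 0 < Nat.clog 2 n := Nat.clog_pos one_lt_two hn
  nlinarith [Nat.mul_le_mul hn hn]

theorem order_eq {n : ℕ} (hn : 2 ≤ n) : order (4 * (n * n * Nat.clog 2 n)) = n := by
  refine le_antisymm ?_ (Nat.le_findGreatest ?_ le_rfl)
  · by_contra hlt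
    have h1 := table_size_lt (show 1 ≤ n by omega) (not_le.mp hlt)
    have h2 := four_mul_tableLength_le (4 * (n * n * Nat.clog 2 n))
    rw [tableLength, digits] at h2
    omega
  · have hc : 0 < Nat.clog 2 n := Nat.clog_pos one_lt_two hn
    nlinarith [Nat.mul_le_mul_left (n * n) hc]

variable {G H : Type*} [Group G] [Group H]

theorem accepts_iff_survives {n k : ℕ} (hk : 0 < k) (hn : 2 ≤ n) (e : G ≃ Fin n) (f : H ≃ Fin n)
    {x : List Bool} (hx : x = pairString (cayleyString e) (cayleyString f)) {t : ℕ}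
    (ht : t ≤ x.length) :
    (circuit k x.length t).Accepts x.get ↔ ∀ T < t, ∀ p : Fin k → G, ∃ q : Fin k → H,
      (∀ i j, p i = p j ↔ q i = q j) ∧ Survives T p q := by
  have hlen : x.length = 4 * (n * n * Nat.clog 2 n) := by
    rw [hx, length_pairString, length_cayleyString, length_cayleyString]
    ring
  have ho : order x.length = n := by rw [hlen, order_eq hn]
  have hd : digits x.length = Nat.clog 2 n := by rw [digits, ho]
  have htl : tableLength x.length = n * n * Nat.clog 2 n := by rw [tableLength, hd, ho]
  have h4 := four_le_table_size hn
  have hget (i : Fin x.length) {b : Bool} (h : x[(i : ℕ)]? = some b) : x.get i = b := by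
    rw [List.getElem?_eq_getElem i.2, Option.some_inj] at h
    exact h
  refine accepts_iff (e := e.trans (finCongr ho.symm)) (f := f.trans (finCongr ho.symm)) hk ht
    (by omega) (by omega) (fun p hp hpN => ?_) (fun a b i hi hp => hget _ ?_)
    (fun a b i hi hp => hget _ ?_)
  · rw [hget ⟨2 * p, hpN⟩ (b := decide (n * n * Nat.clog 2 n ≤ p)) ?_, decide_eq_true_iff]
    · omega
    · change x[2 * p]? = _
      rw [hx]
      have := getElem?_pairString_even (cayleyString e) (cayleyString f) (p := p) (by
        rw [length_cayleyString, length_cayleyString]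
        omega)
      rwa [length_cayleyString] at this
  · have hlt := entry_lt ((e.trans (finCongr ho.symm)) a).2 ((e.trans (finCongr ho.symm)) b).2 hi
    simp only [Equiv.trans_apply, finCongr_apply, Fin.val_cast, ho, hd, htl, Nat.zero_add] at hlt hi ⊢
    rw [hx, getElem?_pairString_odd_left _ _ (by rwa [length_cayleyString]),
      getElem?_cayleyString e a b hi]
  · simp only [Equiv.trans_apply, finCongr_apply, Fin.val_cast, ho, hd, htl] at hi ⊢
    rw [hx, ← length_cayleyString e, getElem?_pairString_odd_right, getElem?_cayleyString f a b hi]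

theorem card_eq_of_accepts {n m k : ℕ} (hn : 1 ≤ n) (hm : 1 ≤ m) (e : G ≃ Fin n) (f : H ≃ Fin m)
    {x : List Bool} (hx : x = pairString (cayleyString e) (cayleyString f)) {t : ℕ}
    (hacc : (circuit k x.length t).Accepts x.get) : n = m := by
  have hlen : x.length = 2 * (n * n * Nat.clog 2 n + m * m * Nat.clog 2 m) := by
    rw [hx, length_pairString, length_cayleyString, length_cayleyString]
  refine table_size_injective hn hm ?_
  by_cases h0 : x.length = 0
  · omega
  have htl := four_mul_tableLength_of_accepts h0 hacc
  have h8 : 8 ≤ x.length := by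
    rcases Nat.lt_or_ge n 2 with h | h
    · rcases Nat.lt_or_ge m 2 with h' | h'
      · obtain rfl : n = 1 := by omega
        obtain rfl : m = 1 := by omega
        exact absurd (by simpa using hlen) h0
      · have := four_le_table_size h'
        omega
    · have := four_le_table_size h
      omega
  have htag (p : ℕ) (hp : p < 2 * tableLength x.length) :
      n * n * Nat.clog 2 n ≤ p ↔ ¬ p < tableLength x.length := by
    have hpN : 2 * p < x.length := by omega
    rw [← tag_of_accepts h8 hacc hp hpN]
    have h := getElem?_pairString_even (cayleyString e) (cayleyString f) (p := p) (by
      rw [length_cayleyString, length_cayleyString]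
      omega)
    rw [← hx, length_cayleyString, List.getElem?_eq_getElem hpN, Option.some_inj] at h
    rw [List.get_eq_getElem, h, decide_eq_true_iff]
  have h1 := htag (tableLength x.length) (by omega)
  rcases Nat.lt_or_ge (n * n * Nat.clog 2 n) (tableLength x.length) with h | h
  · have h2 := htag (n * n * Nat.clog 2 n) (by omega)
    omega
  · omega

theorem accepts_iff_nonempty_mulEquiv [Finite G] [Finite H] {d n m : ℕ} (hd : Group.rank G ≤ d)
    (e : G ≃ Fin n) (f : H ≃ Fin m) {x : List Bool}
    (hx : x = pairString (cayleyString e) (cayleyString f)) {t : ℕ} (ht : t ≤ x.length) {r : ℕ}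
    (hr : derivedSeries G r = ⊥) (hrt : 2 ≤ n → n = m → r * PebbleGame.layerRounds n + 4 ≤ t) :
    (circuit (d + 3) x.length t).Accepts x.get ↔ Nonempty (G ≃* H) := by
  have hcG : Nat.card G = n := by rw [Nat.card_congr e, Nat.card_eq_fintype_card, Fintype.card_fin]
  have hcH : Nat.card H = m := by rw [Nat.card_congr f, Nat.card_eq_fintype_card, Fintype.card_fin]
  have hn : 1 ≤ n := hcG ▸ Nat.card_pos
  have hm : 1 ≤ m := hcH ▸ Nat.card_pos
  by_cases hnm : n = m
  · subst hnm
    rcases Nat.lt_or_ge n 2 with h1 | h2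
    · obtain rfl : n = 1 := by omega
      have : Subsingleton G := (Nat.card_eq_one_iff_unique.mp hcG).1
      have : Subsingleton H := (Nat.card_eq_one_iff_unique.mp hcH).1
      have h0 : x.length = 0 := by
        rw [hx, length_pairString, length_cayleyString, length_cayleyString]
        simp
      obtain rfl := List.length_eq_zero_iff.mp h0
      exact iff_of_true (accepts_of_length_zero _) ⟨MulEquiv.ofBijective (1 : G →* H)
        ⟨fun _ _ _ => Subsingleton.elim _ _, fun _ => ⟨1, Subsingleton.elim _ _⟩⟩⟩
    · rw [accepts_iff_survives (by omega) h2 e f hx ht]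
      constructor
      · intro h
        refine Survives.nonempty_mulEquiv hd hr (hcG.trans hcH.symm) (h _ ?_)
        have := hrt h2 rfl
        rw [hcG]
        omega
      · rintro ⟨φ⟩ T - p
        exact ⟨fun j => φ (p j), fun i j => φ.injective.eq_iff.symm, .of_mulEquiv φ T p⟩
  · refine iff_of_false (fun h => hnm (card_eq_of_accepts hn hm e f hx h)) ?_
    rintro ⟨φ⟩
    exact hnm (by rw [← hcG, ← hcH, Nat.card_congr φ.toEquiv])

end PebbleCircuit

/-! ### The number of rounds -/

namespace PebbleCircuit

/-- An integer close to `log₂ log₂ N`. -/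
def natLogLog (N : ℕ) : ℕ := Nat.log 2 (Nat.log 2 N) + 1

/-- The `q`-th power of the number of rounds, up to rounding. -/
def roundBound (K e N : ℕ) : ℕ := K * natLogLog N ^ e

/-- The number of rounds played by the circuit. -/
def rounds (K e q N : ℕ) : ℕ :=
  Nat.findGreatest (fun ρ => N < roundBound K e N ∨ ρ ^ q ≤ roundBound K e N) N

theorem rounds_le (K e q N : ℕ) : rounds K e q N ≤ N := Nat.findGreatest_le N

theorem rounds_spec {K e q N : ℕ} (hq : q ≠ 0) :
    N < roundBound K e N ∨ rounds K e q N ^ q ≤ roundBound K e N :=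
  Nat.findGreatest_spec (P := fun ρ => N < roundBound K e N ∨ ρ ^ q ≤ roundBound K e N)
    (Nat.zero_le N) (by simp [hq])

theorem le_rounds_iff {K e q N ρ : ℕ} (hq : q ≠ 0) (hρ : ρ ≤ N) :
    ρ ≤ rounds K e q N ↔ N < roundBound K e N ∨ ρ ^ q ≤ roundBound K e N := by
  refine ⟨fun h => ?_, fun h => Nat.le_findGreatest hρ h⟩
  rcases rounds_spec hq with h' | h'
  · exact .inl h'
  · exact .inr ((Nat.pow_le_pow_left h q).trans h')

theorem numFun_roundBound {α : Type} (K e : ℕ) :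
    NumFun fun N (_ : α → Fin (N + 1)) => roundBound K e N :=
  (NumFun.const K).mul ((((NumFun.top.log fun _ _ => le_rfl).log fun N _ =>
    Nat.log_le_self 2 N).add (.const 1)).pow e)

theorem numDef_le_rounds_fun (K e : ℕ) {q : ℕ} (hq : q ≠ 0) :
    NumDef (α := Unit) fun N v => (v () : ℕ) ≤ rounds K e q N :=
  (NumDef.or (NumDef.ex (Q := fun N _ z => (z : ℕ) = roundBound K e N)
      (.var_eq (numFun_roundBound K e) _)).not
    (NumDef.ex (Q := fun N v z => (z : ℕ) = roundBound K e N ∧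
        ∃ u : Fin (N + 1), (u : ℕ) = v () ^ q ∧ (u : ℕ) ≤ z)
      (.and (.var_eq (numFun_roundBound K e) _)
        (.ex (.and (.var_eq ((NumFun.var _).pow q) _) (.var_le _ _)))))).congr fun N v => by
    rw [le_rounds_iff hq (Fin.is_le _)]
    constructor
    · rintro h
      by_cases hlt : N < roundBound K e N
      · refine .inl ?_
        rintro ⟨z, hz⟩
        have := Fin.is_le z
        omega
      · have h' := h.resolve_left hlt
        exact .inr ⟨⟨roundBound K e N, by omega⟩, rfl, ⟨v () ^ q, by omega⟩, rfl, h'⟩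
    · rintro (h | ⟨z, hz, u, hu, hle⟩)
      · refine .inl (not_le.mp fun hle => h ⟨⟨roundBound K e N, by omega⟩, rfl⟩)
      · exact .inr (by omega)

theorem eventually_roundBound_le (K e : ℕ) :
    ∀ᶠ N in Filter.atTop, roundBound K e N ≤ N := by
  have hlog : Filter.Tendsto (fun N => Nat.log 2 N) Filter.atTop Filter.atTop :=
    Filter.tendsto_atTop_mono' _ Filter.EventuallyEq.rfl.le
      (Filter.tendsto_atTop_atTop.mpr fun b => ⟨2 ^ b, fun N hN => Nat.le_log_of_pow_le one_lt_two hN⟩)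
  have hlim := (tendsto_pow_const_div_const_pow_of_one_lt e (one_lt_two (α := ℝ))).const_mul (K : ℝ)
  rw [mul_zero] at hlim
  have hev := hlog.eventually (hlim.eventually (gt_mem_nhds one_pos))
  filter_upwards [hev, Filter.eventually_ge_atTop 2] with N h1 h2
  have hpos : (0 : ℝ) < 2 ^ Nat.log 2 N := by positivity
  rw [← mul_div_assoc, div_lt_one hpos] at h1
  have h1' : K * Nat.log 2 N ^ e < 2 ^ Nat.log 2 N := by exact_mod_cast h1
  have h3 : natLogLog N ≤ Nat.log 2 N :=
    Nat.log_lt_self 2 (Nat.log_pos one_lt_two h2).ne'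
  calc roundBound K e N ≤ K * Nat.log 2 N ^ e := Nat.mul_le_mul_left _ (Nat.pow_le_pow_left h3 e)
    _ ≤ 2 ^ Nat.log 2 N := h1'.le
    _ ≤ N := Nat.pow_log_le_self 2 (by omega)

theorem natLogLog_le {N : ℕ} (hN : 4 ≤ N) : (natLogLog N : ℝ) ≤ 2 * loglog N ∧ 1 ≤ loglog N := by
  have h1 := natLog_natLog_le_loglog (show 2 ≤ N by omega)
  have h2 : 1 ≤ Nat.log 2 (Nat.log 2 N) :=
    Nat.log_pos one_lt_two (Nat.le_log_of_pow_le one_lt_two (by simpa using hN))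
  have h3 : (1 : ℝ) ≤ Nat.log 2 (Nat.log 2 N) := by exact_mod_cast h2
  rw [natLogLog]
  push_cast
  constructor <;> linarith

theorem loglog_le_natLogLog {n N : ℕ} (hn : 2 ≤ n) (hN : n ≤ N) : loglog n ≤ natLogLog N := by
  have h1 : (1 : ℝ) ≤ Real.logb 2 n := by
    rw [Real.le_logb_iff_rpow_le one_lt_two (by positivity), Real.rpow_one]
    exact_mod_cast hn
  have h2 : Real.logb 2 n ≤ (Nat.log 2 N + 1 : ℕ) := by
    rw [Real.logb_le_iff_le_rpow one_lt_two (by positivity), Real.rpow_natCast]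
    exact_mod_cast hN.trans (Nat.lt_pow_succ_log_self one_lt_two N).le
  rw [loglog, Real.logb_le_iff_le_rpow one_lt_two (by linarith), Real.rpow_natCast]
  refine h2.trans ?_
  exact_mod_cast Nat.lt_pow_succ_log_self one_lt_two (Nat.log 2 N)

theorem two_pow_solvabilityClass_le {G : Type*} [Group G] [Finite G] (hG : Group.IsSolvable G) :
    2 ^ solvabilityClass G ≤ Nat.card G := by
  have key : ∀ i ≤ solvabilityClass G, 2 ^ i * Nat.card (derivedSeries G i) ≤ Nat.card G := by
    intro i
    induction i with
    | zero => simp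
    | succ i ih =>
      intro hi
      have hlt : derivedSeries G (i + 1) < derivedSeries G i := by
        refine lt_of_le_of_ne (derivedSeries_antitone G (Nat.le_succ i)) fun heq => ?_
        have hstable : ∀ j, derivedSeries G (i + j) = derivedSeries G i := by
          intro j
          induction j with
          | zero => rfl
          | succ j ihj => rw [← add_assoc, derivedSeries_succ, ihj, ← derivedSeries_succ, heq]
        have h1 := hstable (solvabilityClass G - i)
        rw [Nat.add_sub_cancel' (by omega), derivedSeries_solvabilityClass hG] at h1
        have : solvabilityClass G ≤ i := Nat.sInf_le h1.symm
        omega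
      have h2 := Subgroup.two_mul_card_le_of_lt hlt
      calc 2 ^ (i + 1) * Nat.card (derivedSeries G (i + 1))
          = 2 ^ i * (2 * Nat.card (derivedSeries G (i + 1))) := by ring
        _ ≤ 2 ^ i * Nat.card (derivedSeries G i) := Nat.mul_le_mul_left _ h2
        _ ≤ Nat.card G := ih (by omega)
  have := key _ le_rfl
  rw [derivedSeries_solvabilityClass hG] at this
  simpa using this

theorem game_length_le {r n : ℕ} (hn : 2 ≤ n) (hr : 2 ^ r ≤ n) :
    r * PebbleGame.layerRounds n + 4 ≤ 4 * (n * n * Nat.clog 2 n) := by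
  have h1 := PebbleGame.layerRounds_le hn
  set a := Nat.log 2 n with ha
  have ha1 : 1 ≤ a := Nat.log_pos one_lt_two hn
  have hra : r ≤ a := Nat.le_log_of_pow_le one_lt_two hr
  have hla : Nat.log 2 a ≤ a := Nat.log_le_self 2 a
  have han : a + 1 ≤ n := Nat.log_lt_self 2 (by omega)
  have hc : 1 ≤ Nat.clog 2 n := Nat.clog_pos one_lt_two hn
  calc r * PebbleGame.layerRounds n + 4 ≤ a * (10 + 2 * a) + 4 :=
        Nat.add_le_add_right (Nat.mul_le_mul hra (by omega)) 4
    _ ≤ 4 * ((a + 1) * (a + 1)) := by nlinarith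
    _ ≤ 4 * (n * n) := Nat.mul_le_mul_left 4 (Nat.mul_le_mul han han)
    _ ≤ 4 * (n * n * Nat.clog 2 n) := Nat.mul_le_mul_left 4 (Nat.le_mul_of_pos_right _ hc)

theorem rpow_add_one_pow_den (c : ℚ) (hc : 0 ≤ c) {y : ℝ} (hy : 0 ≤ y) :
    (y ^ ((c : ℝ) + 1)) ^ c.den = y ^ (c.num.toNat + c.den) := by
  rw [← Real.rpow_natCast, ← Real.rpow_mul hy, ← Real.rpow_natCast]
  congr 1
  have h1 : ((c.num.toNat : ℤ) : ℝ) = c.num := by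
    rw [Int.toNat_of_nonneg (Rat.num_nonneg.mpr hc)]
  have h2 : (c : ℝ) * c.den = c.num := by exact_mod_cast Rat.mul_den_eq_num c
  push_cast at h1 ⊢
  rw [add_mul, h2, h1, one_mul]

theorem le_rounds {c : ℚ} (hc : 0 ≤ c) {A : ℝ} {M : ℕ} (hM : 16 * |A| ≤ M) {r n N : ℕ}
    (hn : 2 ≤ n) (hr1 : 1 ≤ r) (hr : (r : ℝ) ≤ A * loglog n ^ (c : ℝ)) (hnN : n ≤ N)
    (hle : r * PebbleGame.layerRounds n + 4 ≤ N) :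
    r * PebbleGame.layerRounds n + 4 ≤ rounds (M ^ c.den) (c.num.toNat + c.den) c.den N := by
  rw [le_rounds_iff c.den_nz hle]
  refine .inr ?_
  set l : ℝ := (natLogLog N : ℝ) with hl
  have hl1 : 1 ≤ l := by
    rw [hl, natLogLog]
    push_cast
    linarith [Nat.cast_nonneg (α := ℝ) (Nat.log 2 (Nat.log 2 N))]
  have hloglog0 : 0 ≤ loglog n :=
    (Nat.cast_nonneg _).trans (natLog_natLog_le_loglog hn)
  have hrl : (r : ℝ) ≤ |A| * l ^ (c : ℝ) := by
    refine hr.trans (mul_le_mul (le_abs_self A) ?_ (by positivity) (abs_nonneg A))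
    exact Real.rpow_le_rpow hloglog0 (loglog_le_natLogLog hn hnN) (by exact_mod_cast hc)
  have hlayer : (PebbleGame.layerRounds n : ℝ) ≤ 12 * l := by
    have h1 := PebbleGame.layerRounds_le hn
    have h2 : Nat.log 2 (Nat.log 2 n) ≤ Nat.log 2 (Nat.log 2 N) :=
      Nat.log_mono_right (Nat.log_mono_right hnN)
    have h3 : PebbleGame.layerRounds n ≤ 12 * natLogLog N := by
      rw [natLogLog]
      omega
    rw [hl]
    exact_mod_cast h3
  have hr1' : (1 : ℝ) ≤ r := by exact_mod_cast hr1
  have hmain : ((r * PebbleGame.layerRounds n + 4 : ℕ) : ℝ) ≤ M * l ^ ((c : ℝ) + 1) := by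
    push_cast
    calc (r : ℝ) * PebbleGame.layerRounds n + 4 ≤ r * (12 * l) + 4 * (r * l) := by
          have := mul_le_mul hr1' hl1 zero_le_one (by linarith)
          have := mul_le_mul_of_nonneg_left hlayer (by linarith : (0 : ℝ) ≤ r)
          linarith
      _ = 16 * (r * l) := by ring
      _ ≤ 16 * (|A| * l ^ (c : ℝ) * l) := by gcongr
      _ = 16 * |A| * l ^ ((c : ℝ) + 1) := by
          rw [Real.rpow_add_one (by linarith)]
          ring
      _ ≤ M * l ^ ((c : ℝ) + 1) := by gcongr
  have hpow := pow_le_pow_left₀ (by positivity) hmain c.den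
  rw [mul_pow, rpow_add_one_pow_den c hc (by linarith)] at hpow
  rw [hl] at hpow
  rw [roundBound]
  exact_mod_cast hpow

theorem rounds_isBigO {c : ℚ} (hc : 0 ≤ c) (K : ℕ) :
    (fun N => ((2 * rounds K (c.num.toNat + c.den) c.den N + 5 : ℕ) : ℝ)) =O[Filter.atTop]
      fun N => loglog N ^ ((c : ℝ) + 1) := by
  set e := c.num.toNat + c.den
  set M : ℕ := K * 2 ^ e
  refine Asymptotics.IsBigO.of_bound (2 * M + 5) ?_
  filter_upwards [eventually_roundBound_le K e, Filter.eventually_ge_atTop 4] with N hN h4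
  obtain ⟨hl, h1⟩ := natLogLog_le h4
  set y := loglog N ^ ((c : ℝ) + 1)
  have hc' : (0 : ℝ) ≤ c := by exact_mod_cast hc
  have hy1 : 1 ≤ y := Real.one_le_rpow h1 (by linarith)
  have hpow : rounds K e c.den N ^ c.den ≤ roundBound K e N :=
    (rounds_spec c.den_nz).resolve_left (not_lt.mpr hN)
  have hle : (rounds K e c.den N : ℝ) ≤ M * y := by
    refine le_of_pow_le_pow_left₀ c.den_nz (by positivity) ?_
    calc (rounds K e c.den N : ℝ) ^ c.den ≤ K * (natLogLog N : ℝ) ^ e := by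
          exact_mod_cast hpow
      _ ≤ K * (2 * loglog N) ^ e := by gcongr
      _ = M * loglog N ^ e := by
          simp only [M]
          push_cast
          ring
      _ ≤ (M : ℝ) ^ c.den * loglog N ^ e := by
          refine mul_le_mul_of_nonneg_right ?_ (by positivity)
          exact_mod_cast Nat.le_self_pow c.den_nz M
      _ = (M * y) ^ c.den := by
          rw [mul_pow, rpow_add_one_pow_den c hc (by linarith)]
  rw [Real.norm_of_nonneg (by positivity), Real.norm_of_nonneg (by linarith)]
  push_cast
  linarith

end PebbleCircuit

theorem exists_language_in_FO (d : ℕ) (c : ℚ) (A : ℝ) (hc : 0 ≤ c) :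
    ∃ L : Language Bool, InFO (fun N => loglog N ^ ((c : ℝ) + 1)) L ∧
      ∀ (G : Type*) [Group G] [Finite G] (H : Type*) [Group H] [Finite H]
        (n m : ℕ) (e : G ≃ Fin n) (f : H ≃ Fin m),
        Group.IsSolvable G → Group.rank G ≤ d →
        (solvabilityClass G : ℝ) ≤ A * loglog n ^ (c : ℝ) →
          (pairString (cayleyString e) (cayleyString f) ∈ L ↔ Nonempty (G ≃* H)) := by
  let M := ⌈16 * |A|⌉₊
  let t : ℕ → ℕ := PebbleCircuit.rounds (M ^ c.den) (c.num.toNat + c.den) c.den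
  let C : (N : ℕ) → BoolCircuit N := fun N => PebbleCircuit.circuit (d + 3) N (t N)
  refine ⟨{x | (C x.length).Accepts x.get}, ⟨C, PebbleCircuit.foUniform_circuit
    (PebbleCircuit.numDef_le_rounds_fun _ _ c.den_nz) (d + 3),
    ⟨_, fun N => (PebbleCircuit.size_circuit (d + 3) N (t N)).le⟩,
    ⟨fun N => 2 * t N + 5, fun N => PebbleCircuit.depthLE_circuit _ _ _,
      PebbleCircuit.rounds_isBigO hc _⟩, fun x => Iff.rfl⟩, ?_⟩
  intro G _ _ H _ _ n m e f hG hd hr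
  refine PebbleCircuit.accepts_iff_nonempty_mulEquiv hd e f rfl (PebbleCircuit.rounds_le _ _ _ _)
    (derivedSeries_solvabilityClass hG) ?_
  rintro hn rfl
  have hcG : Nat.card G = n := by rw [Nat.card_congr e, Nat.card_eq_fintype_card, Fintype.card_fin]
  have hlen : (pairString (cayleyString e) (cayleyString f)).length =
      4 * (n * n * Nat.clog 2 n) := by
    rw [length_pairString, length_cayleyString, length_cayleyString]
    ring
  have : Nontrivial G := Finite.one_lt_card_iff_nontrivial.mp (by omega)
  refine PebbleCircuit.le_rounds hc (Nat.le_ceil _) hn (solvabilityClass_pos hG) hr ?_ ?_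
  · rw [hlen]
    have hcl : 0 < Nat.clog 2 n := Nat.clog_pos one_lt_two hn
    nlinarith [Nat.mul_le_mul_left (n * n) hcl]
  · rw [hlen]
    exact PebbleCircuit.game_length_le hn (hcG ▸ PebbleCircuit.two_pow_solvabilityClass_le hG)

theorem mainTheorem7 (d : ℕ) :
    (∃ (k : ℕ) (C : ℝ), ∀ (G : Type*) [Group G] [Finite G] (H : Type*) [Group H] [Finite H],
      Group.IsSolvable G → Group.rank G ≤ d → ¬ Nonempty (G ≃* H) →
        CountFreeWL.Distinguishes k
          ⌊C * solvabilityClass G * loglog (Nat.card G)⌋₊ G H) ∧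
    (∀ (c : ℚ) (A : ℝ), 0 ≤ c →
      ∃ L : Language Bool, InFO (fun N => loglog N ^ ((c : ℝ) + 1)) L ∧
        ∀ (G : Type*) [Group G] [Finite G] (H : Type*) [Group H] [Finite H]
          (n m : ℕ) (e : G ≃ Fin n) (f : H ≃ Fin m),
          Group.IsSolvable G → Group.rank G ≤ d →
          (solvabilityClass G : ℝ) ≤ A * loglog n ^ (c : ℝ) →
            (pairString (cayleyString e) (cayleyString f) ∈ L ↔ Nonempty (G ≃* H))) := by
  exact ⟨⟨d + 3, 30, fun G _ _ H _ _ hG hd h => distinguishes_of_solvable hG hd h⟩,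
    fun c A hc => exists_language_in_FO d c A hc⟩
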